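/- Let $p\in(0,1/2]$ and $\lambda\ge 0$ be fixed. For every sufficiently large real $d$ let $a=a(d)$, $b=b(d)$, $c=c(d)$ be real numbers with $$pa+(1-p)b=pb+(1-p)c=1,\qquad d(1-b)^2=\lambda .$$ For $n\ge 1$ consider the stochastic block model: the labels $X_1,\dots,X_n\in\{1,2\}$ are independent with $\mathbb P(X_i=1)=p$ and, given the labels, each pair $\{i,j\}$ is an edge of the random graph $\mathcal G$ on $\{1,\dots,n\}$, independently, with probability $M_{X_i,X_j}$, where $$M=\frac dn\begin{pmatrix}a&b\\ b&c\end{pmatrix}$$ (for $d$ large and then $n$ large the entries of $M$ lie in $[0,1]$). For an estimator $T=(T_1,\dots,T_n)$ with values in $\{1,2\}^n$ that is a function of $\mathcal G$ only (no label is revealed), put $$P_{succ}(T)=\frac1n\sum_{i=1}^n\Big(\mathbb P(T_i(\mathcal G)=1\mid X_i=1)+\mathbb P(T_i(\mathcal G)=2\mid X_i=2)-1\Big),$$ and let $T^{opt}$ be the optimal test: $T^{opt}_i(\mathcal G)=1$ if $\frac{\mathbb P(X_i=1\mid \mathcal G)}{\mathbb P(X_i=2\mid \mathcal G)}\ge\frac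 p{1-p}$, and $T^{opt}_i(\mathcal G)=2$ otherwise. For $\mu\ge0$ let $$G(\mu)=\frac{\lambda}{(1-p)^2}\,\mathbb E\Big[\frac1{p+(1-p)\exp(\sqrt\mu Z-\mu/2)}-1\Big],\qquad Z\sim\mathcal N(0,1).$$ Then the sequence $\mu_1=\frac{\lambda}{p(1-p)}$, $\mu_{k+1}=G(\mu_k)$ converges to a limit $\mu_\infty\ge0$, and $$\limsup_{d\to\infty}\ \limsup_{n\to\infty}\ P_{succ}(T^{opt})\ \le\ 2\,\mathbb P\big(\mathcal N(\mu_\infty/2,\mu_\infty)>0\big)-1 ,$$ where the right-hand side is read as its limiting value $0$ when $\mu_\infty=0$. -/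

import Mathlib

open MeasureTheory ProbabilityTheory Filter Topology

namespace SBM

/-- A configuration of the model on `n` vertices: the labels `X` and the observed graph `G`.
Label `0 : Fin 2` is class 1 and label `1 : Fin 2` is class 2. -/
abbrev Config (n : ℕ) : Type := (Fin n → Fin 2) × SimpleGraph (Fin n)

/-- The law of a single label: class 1 has probability `p`, class 2 has probability `1 - p`. -/
def labelProb (p : ℝ) (k : Fin 2) : ℝ := if k = 0 then p else 1 - p

open scoped Classical in
/-- Probability of a configuration in the stochastic block model with parameters `(M, n, p)`:
the labels are i.i.d. and, conditionally on the labels, the edges `{i, j}` are independent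
Bernoulli variables with mean `M (X i) (X j)`.  (A genuine probability as soon as `p` and the
entries of `M` lie in `[0, 1]`.) -/
noncomputable def weight (p : ℝ) {n : ℕ} (M : Matrix (Fin 2) (Fin 2) ℝ) (ω : Config n) : ℝ :=
  (∏ i, labelProb p (ω.1 i)) *
    ∏ e : Fin n × Fin n with e.1 < e.2,
      if ω.2.Adj e.1 e.2 then M (ω.1 e.1) (ω.1 e.2) else 1 - M (ω.1 e.1) (ω.1 e.2)

open scoped Classical in
/-- Probability of an event under the stochastic block model. -/
noncomputable def prob (p : ℝ) {n : ℕ} (M : Matrix (Fin 2) (Fin 2) ℝ) (A : Set (Config n)) : ℝ :=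
  ∑ ω : Config n, A.indicator (weight p M) ω

/-- Conditional probability `P(A | B)`. -/
noncomputable def condProb (p : ℝ) {n : ℕ} (M : Matrix (Fin 2) (Fin 2) ℝ)
    (A B : Set (Config n)) : ℝ :=
  prob p M (A ∩ B) / prob p M B

/-- The event `X i = k`. -/
def labelEvent {n : ℕ} (i : Fin n) (k : Fin 2) : Set (Config n) := {ω | ω.1 i = k}

/-- The event that the observed graph is `g`. -/
def graphEvent {n : ℕ} (g : SimpleGraph (Fin n)) : Set (Config n) := {ω | ω.2 = g}

/-- An estimator of the labels: a function of the observed graph only. -/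
abbrev Estimator (n : ℕ) : Type := SimpleGraph (Fin n) → Fin n → Fin 2

/-- The rescaled average success probability
`(1/n) ∑ i, (P(T_i(G) = 1 | X_i = 1) + P(T_i(G) = 2 | X_i = 2) - 1)`. -/
noncomputable def successProb (p : ℝ) {n : ℕ} (M : Matrix (Fin 2) (Fin 2) ℝ)
    (T : Estimator n) : ℝ :=
  (1 / (n : ℝ)) * ∑ i : Fin n,
    (condProb p M {ω | T ω.2 i = 0} (labelEvent i 0)
      + condProb p M {ω | T ω.2 i = 1} (labelEvent i 1) - 1)

open scoped Classical in
/-- The optimal test: class 1 iff `P(X_i = 1 | G) / P(X_i = 2 | G) ≥ p / (1 - p)`.  The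
inequality is written without quotients and logarithms, so that it is also the right one when a
posterior probability vanishes. -/
noncomputable def optimalTest (p : ℝ) {n : ℕ} (M : Matrix (Fin 2) (Fin 2) ℝ) : Estimator n :=
  fun g i =>
    if p * condProb p M (labelEvent i 1) (graphEvent g)
        ≤ (1 - p) * condProb p M (labelEvent i 0) (graphEvent g)
    then 0 else 1

/-- The connectivity matrix `(d / n) * [[a, b], [b, c]]`. -/
noncomputable def connectivity (a b c d : ℝ) (n : ℕ) : Matrix (Fin 2) (Fin 2) ℝ :=
  (d / (n : ℝ)) • !![a, b; b, c]

/-- `G(μ) = λ / (1 - p)² * E[1 / (p + (1 - p) exp(√μ Z - μ / 2)) - 1]` with `Z ∼ N(0, 1)`. -/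
noncomputable def G (p lam μ : ℝ) : ℝ :=
  lam / (1 - p) ^ 2 *
    ∫ z, (1 / (p + (1 - p) * Real.exp (Real.sqrt μ * z - μ / 2)) - 1) ∂(gaussianReal 0 1)

/-- The sequence `μ₁ = q λ / (p (1 - p))`, `μ_{k+1} = G(μ_k)`; here `muSeq p lam q k` is
`μ_{k+1}`. -/
noncomputable def muSeq (p lam q : ℝ) : ℕ → ℝ
  | 0 => q * lam / (p * (1 - p))
  | k + 1 => G p lam (muSeq p lam q k)

/-- `2 P(N(μ/2, μ) > 0) - 1` for `μ > 0`, extended by its limit `0` at `μ = 0` (where the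
Gaussian degenerates to a Dirac mass at `0`). -/
noncomputable def gaussianSuccess (μ : ℝ) : ℝ :=
  if μ = 0 then 0 else 2 * (gaussianReal (μ / 2) μ.toNNReal).real (Set.Ioi 0) - 1

end SBM

/-! For any estimator and any vertex, the sum of the two conditional success probabilities minus one
is at most the total variation distance between the laws of the graph given the two labels of that
vertex. This distance is half of an `L¹` norm, `obsNorm`, of a signed mixture with coefficients `1`
and `-1` on the label (`successProb_le`). It remains to bound this norm, first as `n → ∞`, then as
`d → ∞`.

Graph side. No coupling of neighbourhoods with trees is built; signed laws with finitely many roots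
and arbitrary coefficients are compared directly. The edges at one root `v` are exposed
(`obsNorm_root_le`). Pairs joining `v` to boundedly many exceptional vertices cost `O(1/n)`. Absent
edges to fresh vertices carry asymptotically no information, because both labels have the same mean
degree. The neighbours become new roots, the label of `v` is summed out through the transition
kernel, and the binomial degree becomes Poisson. After `r` generations the labels are revealed,
which can only increase the norm. Hence the depth-`r` broadcast experiment on a Poisson
Galton-Watson tree dominates asymptotically (`riskBound_treeExperiment_cons`).

Tree side. The log-likelihood ratio at the root is compound Poisson with intensity `d` and jumps of
order `|1 - b| = √(λ/d)`. A second order expansion of its characteristic function shows that it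
tends to `N(-μ/2, μ)`, where `μ` is the limit of `λ` times the chi-square information `infoV` of a
child. The information one level up is a bounded continuous functional of the log-ratio and
reproduces `G`, so `λ * infoV` at depth `r` tends to `muSeq p lam 1 r`
(`tendsto_infoV_treeExperiment`). Similarly half the risk at depth `r + 1` tends to `gaussianSuccess
(muSeq p lam 1 r)`.

Finally, `G` is nondecreasing by Jensen and bounded by `λ/(p(1-p))`, so the sequence decreases to a
limit; continuity of the Gaussian success in `μ` allows `r → ∞`. -/

namespace SBM
open scoped ENNReal

/-! ### Binary experiments, their risk, and the broadcast recursion on the tree. -/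

/-- The Bayes risk functional of a list of independent binary experiments, each of them given by
the law of its pair of likelihoods: the total mass of the signed mixture with coefficients `c`. -/
noncomputable def risk : List (Measure (Fin 2 → ℝ)) → (List (Fin 2) → ℝ) → ℝ≥0∞
  | [], c => ‖c []‖ₑ
  | ν :: l, c => ∫⁻ ℓ, risk l (fun xs => ∑ x, ℓ x * c (x :: xs)) ∂ν

/-- Measurability is needed in the whole coefficient function, because each integration feeds
coefficients depending on `ℓ` into the rest of the list; Tonelli carries the induction. -/
lemma measurable_risk (l : List (Measure (Fin 2 → ℝ))) (hl : ∀ ν ∈ l, SFinite ν) :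
    Measurable (risk l) := by
  induction l with
  | nil => exact (measurable_pi_apply []).enorm
  | cons ν l ih =>
    have : SFinite ν := hl ν (by simp)
    have ih := ih fun ν' h => hl ν' (by simp [h])
    have h : Measurable fun q : (List (Fin 2) → ℝ) × (Fin 2 → ℝ) =>
        risk l (fun xs => ∑ x, q.2 x * q.1 (x :: xs)) := by
      refine ih.comp (measurable_pi_lambda _ fun xs => ?_)
      refine Finset.measurable_sum _ fun x _ => ?_
      exact ((measurable_pi_apply x).comp measurable_snd).mul
        ((measurable_pi_apply (x :: xs)).comp measurable_fst)
    exact h.lintegral_prod_right'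

lemma risk_const_mul (l : List (Measure (Fin 2 → ℝ))) (r : ℝ) (c : List (Fin 2) → ℝ) :
    risk l (fun xs => r * c xs) = ‖r‖ₑ * risk l c := by
  induction l generalizing c with
  | nil => simp [risk]
  | cons ν l ih =>
    simp only [risk]
    rw [← lintegral_const_mul' _ _ enorm_ne_top]
    refine lintegral_congr fun ℓ => ?_
    rw [← ih]
    congr 1
    ext xs
    rw [Finset.mul_sum]
    exact Finset.sum_congr rfl fun x _ => by ring

/-- Likelihoods of a binary experiment: nonnegative, not both zero, of total mass one. -/
structure IsExperiment (ν : Measure (Fin 2 → ℝ)) : Prop where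
  finite : IsFiniteMeasure ν
  nonneg : ∀ᵐ ℓ ∂ν, ∀ x, 0 ≤ ℓ x
  pos : ∀ᵐ ℓ ∂ν, 0 < ℓ 0 + ℓ 1
  mass : ∀ x, ∫⁻ ℓ, ENNReal.ofReal (ℓ x) ∂ν = 1

/-- The two likelihoods integrate to total mass two, so each experiment costs a factor `2`. This
serves to keep the risks finite. -/
lemma risk_le {l : List (Measure (Fin 2 → ℝ))} (hl : ∀ ν ∈ l, IsExperiment ν)
    (c : List (Fin 2) → ℝ) (B : ℝ≥0∞) (hc : ∀ xs, ‖c xs‖ₑ ≤ B) :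
    risk l c ≤ 2 ^ l.length * B := by
  induction l generalizing c B with
  | nil => simpa [risk] using hc []
  | cons ν l ih =>
    have hν := hl ν (by simp)
    have ih := ih fun ν' h => hl ν' (by simp [h])
    calc risk (ν :: l) c
        ≤ ∫⁻ ℓ, 2 ^ l.length * B * (ENNReal.ofReal (ℓ 0) + ENNReal.ofReal (ℓ 1)) ∂ν := by
          refine lintegral_mono_ae ?_
          filter_upwards [hν.nonneg] with ℓ hℓ
          rw [mul_assoc]
          refine ih _ _ fun xs => ?_
          rw [Fin.sum_univ_two]
          refine (enorm_add_le _ _).trans ?_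
          rw [enorm_mul, enorm_mul, Real.enorm_of_nonneg (hℓ 0), Real.enorm_of_nonneg (hℓ 1),
            mul_add, mul_comm B, mul_comm B]
          gcongr <;> exact hc _
      _ = 2 ^ (ν :: l).length * B := by
          rw [lintegral_const_mul _ (by fun_prop), lintegral_add_left (by fun_prop),
            hν.mass, hν.mass, List.length_cons, pow_succ]
          ring

/-- Likelihood of the parent label `x` when the child has likelihoods `ℓ`. -/
noncomputable def parentLik (κ : Fin 2 → Fin 2 → ℝ) (ℓ : Fin 2 → ℝ) (x : Fin 2) : ℝ :=
  ∑ y, κ x y * ℓ y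

/-- The law of the log-likelihood ratio contributed by one child, when the root has label `0`. -/
noncomputable def jump (κ : Fin 2 → Fin 2 → ℝ) (ν : Measure (Fin 2 → ℝ)) : Measure ℝ :=
  (ν.withDensity fun ℓ => ENNReal.ofReal (parentLik κ ℓ 0)).map
    fun ℓ => Real.log (parentLik κ ℓ 1 / parentLik κ ℓ 0)

/-- Convolution powers of a measure on the real line. -/
noncomputable def convPow (J : Measure ℝ) : ℕ → Measure ℝ
  | 0 => Measure.dirac 0
  | k + 1 => J.conv (convPow J k)

/-- Weights of the Poisson law of mean `d`. -/
noncomputable def poissonWeight (d : ℝ) (k : ℕ) : ℝ := Real.exp (-d) * d ^ k / (k.factorial : ℝ)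

/-- The compound Poisson law of intensity `d` and jump law `J`. -/
noncomputable def compoundPoisson (d : ℝ) (J : Measure ℝ) : Measure ℝ :=
  Measure.sum fun k => ENNReal.ofReal (poissonWeight d k) • convPow J k

/-- The pair of likelihoods normalised at label `0`, with log-likelihood ratio `u`. -/
noncomputable def likPair (u : ℝ) (x : Fin 2) : ℝ := if x = 0 then 1 else Real.exp u

/-- The experiment given by a Poisson number of children carrying the experiment `ν`. -/
noncomputable def nextLevel (κ : Fin 2 → Fin 2 → ℝ) (d : ℝ) (ν : Measure (Fin 2 → ℝ)) :
    Measure (Fin 2 → ℝ) :=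
  (compoundPoisson d (jump κ ν)).map likPair

/-- The broadcast experiment of depth `r` on the Galton-Watson tree, with the labels at depth `r`
revealed. -/
noncomputable def treeExperiment (κ : Fin 2 → Fin 2 → ℝ) (d : ℝ) : ℕ → Measure (Fin 2 → ℝ)
  | 0 => Measure.dirac (Pi.single 0 1) + Measure.dirac (Pi.single 1 1)
  | r + 1 => nextLevel κ d (treeExperiment κ d r)

/-- Coefficients after replacing the first label by those of `k` children. -/
noncomputable def pushRoot (κ : Fin 2 → Fin 2 → ℝ) (k : ℕ) (c : List (Fin 2) → ℝ)
    (zs : List (Fin 2)) : ℝ :=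
  ∑ x, ((zs.take k).map (κ x)).prod * c (x :: zs.drop k)

lemma measurable_likPair : Measurable likPair := by
  refine measurable_pi_lambda _ fun x => ?_
  unfold likPair
  split_ifs <;> fun_prop

@[fun_prop]
lemma measurable_parentLik (κ : Fin 2 → Fin 2 → ℝ) (x : Fin 2) :
    Measurable fun ℓ => parentLik κ ℓ x := by
  unfold parentLik; fun_prop

lemma parentLik_pos {κ : Fin 2 → Fin 2 → ℝ} (hκ : ∀ x y, 0 < κ x y) {ℓ : Fin 2 → ℝ}
    (h0 : ∀ x, 0 ≤ ℓ x) (h1 : 0 < ℓ 0 + ℓ 1) (x : Fin 2) : 0 < parentLik κ ℓ x := by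
  unfold parentLik
  rw [Fin.sum_univ_two]
  have := mul_nonneg (hκ x 0).le (h0 0)
  have := mul_nonneg (hκ x 1).le (h0 1)
  rcases (h0 0).lt_or_eq with h | h
  · have := mul_pos (hκ x 0) h
    linarith
  · have := mul_pos (hκ x 1) (show 0 < ℓ 1 by linarith)
    linarith

lemma IsExperiment.parentLik_pos {κ : Fin 2 → Fin 2 → ℝ} (hκ : ∀ x y, 0 < κ x y)
    {ν : Measure (Fin 2 → ℝ)} (hν : IsExperiment ν) : ∀ᵐ ℓ ∂ν, ∀ x, 0 < parentLik κ ℓ x := by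
  filter_upwards [hν.nonneg, hν.pos] with ℓ h0 h1 x using SBM.parentLik_pos hκ h0 h1 x

lemma IsExperiment.lintegral_parentLik {κ : Fin 2 → Fin 2 → ℝ} (hκ : ∀ x y, 0 < κ x y)
    (hκ1 : ∀ x, ∑ y, κ x y = 1)
    {ν : Measure (Fin 2 → ℝ)} (hν : IsExperiment ν) (x : Fin 2) :
    ∫⁻ ℓ, ENNReal.ofReal (parentLik κ ℓ x) ∂ν = 1 := by
  calc ∫⁻ ℓ, ENNReal.ofReal (parentLik κ ℓ x) ∂ν
      = ∫⁻ ℓ, ENNReal.ofReal (κ x 0) * ENNReal.ofReal (ℓ 0)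
          + ENNReal.ofReal (κ x 1) * ENNReal.ofReal (ℓ 1) ∂ν := by
        refine lintegral_congr_ae ?_
        filter_upwards [hν.nonneg] with ℓ h0
        rw [parentLik, Fin.sum_univ_two, ENNReal.ofReal_add (mul_nonneg (hκ x 0).le (h0 0))
          (mul_nonneg (hκ x 1).le (h0 1)), ENNReal.ofReal_mul (hκ x 0).le,
          ENNReal.ofReal_mul (hκ x 1).le]
    _ = 1 := by
        rw [lintegral_add_left (by fun_prop), lintegral_const_mul _ (by fun_prop),
          lintegral_const_mul _ (by fun_prop), hν.mass, hν.mass, mul_one, mul_one,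
          ← ENNReal.ofReal_add (hκ x 0).le (hκ x 1).le, ← Fin.sum_univ_two, hκ1,
          ENNReal.ofReal_one]

lemma measurable_logRatio (κ : Fin 2 → Fin 2 → ℝ) :
    Measurable fun ℓ : Fin 2 → ℝ => Real.log (parentLik κ ℓ 1 / parentLik κ ℓ 0) := by
  fun_prop

lemma lintegral_jump (κ : Fin 2 → Fin 2 → ℝ) (ν : Measure (Fin 2 → ℝ)) {F : ℝ → ℝ≥0∞}
    (hF : Measurable F) :
    ∫⁻ u, F u ∂(jump κ ν) = ∫⁻ ℓ, ENNReal.ofReal (parentLik κ ℓ 0) *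
      F (Real.log (parentLik κ ℓ 1 / parentLik κ ℓ 0)) ∂ν := by
  rw [jump, lintegral_map hF (measurable_logRatio κ)]
  exact lintegral_withDensity_eq_lintegral_mul _ (by fun_prop) (hF.comp (measurable_logRatio κ))

lemma isProbabilityMeasure_jump {κ : Fin 2 → Fin 2 → ℝ} (hκ : ∀ x y, 0 < κ x y)
    (hκ1 : ∀ x, ∑ y, κ x y = 1) {ν : Measure (Fin 2 → ℝ)} (hν : IsExperiment ν) :
    IsProbabilityMeasure (jump κ ν) := by
  constructor
  rw [← lintegral_one, lintegral_jump κ ν measurable_const]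
  simpa using hν.lintegral_parentLik hκ hκ1 0

/-- The density under label `0` times the likelihood ratio is the density under label `1`, which
also has mass one. -/
lemma lintegral_exp_jump {κ : Fin 2 → Fin 2 → ℝ} (hκ : ∀ x y, 0 < κ x y)
    (hκ1 : ∀ x, ∑ y, κ x y = 1) {ν : Measure (Fin 2 → ℝ)} (hν : IsExperiment ν) :
    ∫⁻ u, ENNReal.ofReal (Real.exp u) ∂(jump κ ν) = 1 := by
  rw [lintegral_jump κ ν (by fun_prop), ← hν.lintegral_parentLik hκ hκ1 1]
  refine lintegral_congr_ae ?_
  filter_upwards [hν.parentLik_pos hκ] with ℓ h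
  rw [Real.exp_log (div_pos (h 1) (h 0)), ← ENNReal.ofReal_mul (h 0).le,
    mul_div_cancel₀ _ (h 0).ne']

instance isProbabilityMeasure_convPow (J : Measure ℝ) [IsProbabilityMeasure J] (k : ℕ) :
    IsProbabilityMeasure (convPow J k) := by
  induction k with
  | zero => unfold convPow; infer_instance
  | succ k ih => unfold convPow; infer_instance

lemma lintegral_exp_convPow (J : Measure ℝ) [IsProbabilityMeasure J]
    (hJ : ∫⁻ u, ENNReal.ofReal (Real.exp u) ∂J = 1) (k : ℕ) :
    ∫⁻ u, ENNReal.ofReal (Real.exp u) ∂(convPow J k) = 1 := by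
  induction k with
  | zero => simp [convPow]
  | succ k ih =>
    rw [convPow, Measure.lintegral_conv (by fun_prop)]
    simp_rw [Real.exp_add, ENNReal.ofReal_mul (Real.exp_pos _).le]
    simp_rw [lintegral_const_mul' _ _ ENNReal.ofReal_ne_top, ih, mul_one, hJ]

lemma poissonWeight_nonneg {d : ℝ} (hd : 0 ≤ d) (k : ℕ) : 0 ≤ poissonWeight d k := by
  unfold poissonWeight; positivity

lemma hasSum_poissonWeight {d : ℝ} (hd : 0 ≤ d) : HasSum (poissonWeight d) 1 :=
  hasSum_one_poissonMeasure ⟨d, hd⟩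

lemma tsum_ofReal_poissonWeight {d : ℝ} (hd : 0 ≤ d) :
    ∑' k, ENNReal.ofReal (poissonWeight d k) = 1 := by
  rw [← ENNReal.ofReal_tsum_of_nonneg (poissonWeight_nonneg hd) (hasSum_poissonWeight hd).summable,
    (hasSum_poissonWeight hd).tsum_eq, ENNReal.ofReal_one]

lemma lintegral_compoundPoisson (d : ℝ) (J : Measure ℝ) (F : ℝ → ℝ≥0∞) :
    ∫⁻ u, F u ∂(compoundPoisson d J) =
      ∑' k, ENNReal.ofReal (poissonWeight d k) * ∫⁻ u, F u ∂(convPow J k) := by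
  simp [compoundPoisson, lintegral_sum_measure, lintegral_smul_measure]

lemma isProbabilityMeasure_compoundPoisson {d : ℝ} (hd : 0 ≤ d) (J : Measure ℝ)
    [IsProbabilityMeasure J] : IsProbabilityMeasure (compoundPoisson d J) := by
  constructor
  rw [← lintegral_one, lintegral_compoundPoisson]
  simpa using tsum_ofReal_poissonWeight hd

lemma lintegral_exp_compoundPoisson {d : ℝ} (hd : 0 ≤ d) (J : Measure ℝ) [IsProbabilityMeasure J]
    (hJ : ∫⁻ u, ENNReal.ofReal (Real.exp u) ∂J = 1) :
    ∫⁻ u, ENNReal.ofReal (Real.exp u) ∂(compoundPoisson d J) = 1 := by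
  rw [lintegral_compoundPoisson]
  simpa [lintegral_exp_convPow J hJ] using tsum_ofReal_poissonWeight hd

lemma isExperiment_map_likPair {P : Measure ℝ} [IsProbabilityMeasure P]
    (hP : ∫⁻ u, ENNReal.ofReal (Real.exp u) ∂P = 1) : IsExperiment (P.map likPair) where
  finite := inferInstance
  nonneg := by
    rw [ae_map_iff measurable_likPair.aemeasurable (by measurability)]
    refine ae_of_all _ fun u x => ?_
    unfold likPair; split_ifs <;> positivity
  pos := by
    rw [ae_map_iff measurable_likPair.aemeasurable (by measurability)]
    refine ae_of_all _ fun u => ?_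
    simp only [likPair, if_true, one_ne_zero, if_false]; positivity
  mass x := by
    rw [lintegral_map (by fun_prop) measurable_likPair]
    unfold likPair
    by_cases hx : x = 0 <;> simp [hx, hP]

lemma isExperiment_nextLevel {κ : Fin 2 → Fin 2 → ℝ} (hκ : ∀ x y, 0 < κ x y)
    (hκ1 : ∀ x, ∑ y, κ x y = 1) {d : ℝ} (hd : 0 ≤ d) {ν : Measure (Fin 2 → ℝ)}
    (hν : IsExperiment ν) : IsExperiment (nextLevel κ d ν) := by
  have := isProbabilityMeasure_jump hκ hκ1 hν
  have := isProbabilityMeasure_compoundPoisson hd (jump κ ν)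
  exact isExperiment_map_likPair
    (lintegral_exp_compoundPoisson hd _ (lintegral_exp_jump hκ hκ1 hν))

lemma isExperiment_treeExperiment {κ : Fin 2 → Fin 2 → ℝ} (hκ : ∀ x y, 0 < κ x y)
    (hκ1 : ∀ x, ∑ y, κ x y = 1) {d : ℝ} (hd : 0 ≤ d) (r : ℕ) :
    IsExperiment (treeExperiment κ d r) := by
  induction r with
  | zero =>
    unfold treeExperiment
    refine ⟨inferInstance, ?_, ?_, fun x => ?_⟩
    · rw [ae_add_measure_iff, ae_dirac_iff (by measurability), ae_dirac_iff (by measurability)]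
      refine ⟨fun x => ?_, fun x => ?_⟩ <;> fin_cases x <;> simp
    · rw [ae_add_measure_iff, ae_dirac_iff (by measurability), ae_dirac_iff (by measurability)]
      simp
    · rw [lintegral_add_measure, lintegral_dirac' _ (by fun_prop), lintegral_dirac' _ (by fun_prop)]
      fin_cases x <;> simp
  | succ r ih => exact isExperiment_nextLevel hκ hκ1 hd ih

/-- The weights `g` carry the likelihoods of the children already integrated out. A further child
multiplies them by `parentLik`; after factoring out its value at label `0`, only a log-ratio with
law `jump` remains. Successive log-ratios add, hence the convolution power. -/
lemma risk_replicate_append {κ : Fin 2 → Fin 2 → ℝ} (hκ : ∀ x y, 0 < κ x y)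
    (hκ1 : ∀ x, ∑ y, κ x y = 1) {ν : Measure (Fin 2 → ℝ)} (hν : IsExperiment ν)
    {l : List (Measure (Fin 2 → ℝ))} (hl : ∀ ν ∈ l, IsExperiment ν) (k : ℕ)
    (g : Fin 2 → ℝ) (c : List (Fin 2) → ℝ) :
    risk (List.replicate k ν ++ l)
        (fun zs => ∑ x, ((zs.take k).map (κ x)).prod * (g x * c (x :: zs.drop k))) =
      ∫⁻ u, risk l (fun xs => ∑ x, likPair u x * (g x * c (x :: xs))) ∂(convPow (jump κ ν) k) := by
  have hJ := isProbabilityMeasure_jump hκ hκ1 hν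
  have hmeas : ∀ g : Fin 2 → ℝ, Measurable fun u =>
      risk l (fun xs => ∑ x, likPair u x * (g x * c (x :: xs))) := fun g => by
    refine (measurable_risk l fun ν h => ?_).comp (measurable_pi_lambda _ fun xs => ?_)
    · have := (hl ν h).finite
      infer_instance
    · refine Finset.measurable_sum _ fun x _ => ?_
      exact ((measurable_pi_apply x).comp measurable_likPair).mul_const _
  induction k generalizing g with
  | zero =>
    rw [convPow, lintegral_dirac' _ (hmeas g)]
    simp [likPair]
  | succ k ih =>
    rw [convPow, Measure.lintegral_conv (hmeas g), lintegral_jump κ ν]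
    · rw [List.replicate_succ, List.cons_append, risk]
      refine lintegral_congr_ae ?_
      filter_upwards [hν.parentLik_pos hκ] with ℓ h
      have e1 : (fun xs => ∑ y, ℓ y * ∑ x, (((y :: xs).take (k + 1)).map (κ x)).prod *
            (g x * c (x :: (y :: xs).drop (k + 1)))) =
          fun zs => ∑ x, ((zs.take k).map (κ x)).prod *
            ((g x * parentLik κ ℓ x) * c (x :: zs.drop k)) := by
        ext xs
        simp only [List.take_succ_cons, List.map_cons, List.prod_cons, List.drop_succ_cons,
          parentLik, Fin.sum_univ_two]
        ring
      rw [e1, ih, ← lintegral_const_mul' _ _ ENNReal.ofReal_ne_top]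
      refine lintegral_congr fun u => ?_
      -- Homogeneity of the risk moves the density of `jump` inside, where it restores the
      -- unnormalised pair of parent likelihoods.
      rw [← Real.enorm_of_nonneg (h 0).le, ← risk_const_mul]
      congr 1
      ext xs
      simp only [Fin.sum_univ_two, likPair, if_true, one_ne_zero, if_false, Real.exp_add]
      rw [Real.exp_log (div_pos (h 1) (h 0))]
      field_simp [(h 0).ne']
    · exact Measurable.lintegral_prod_right' (f := fun q : ℝ × ℝ => risk l (fun xs => ∑ x,
        likPair (q.1 + q.2) x * (g x * c (x :: xs)))) ((hmeas g).comp measurable_add)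

/-- The tree counterpart of exposing a root in the graph: a Poisson number of children replaces it,
with pushed coefficients. -/
lemma risk_nextLevel_cons {κ : Fin 2 → Fin 2 → ℝ} (hκ : ∀ x y, 0 < κ x y)
    (hκ1 : ∀ x, ∑ y, κ x y = 1) (d : ℝ) {ν : Measure (Fin 2 → ℝ)} (hν : IsExperiment ν)
    {l : List (Measure (Fin 2 → ℝ))} (hl : ∀ ν ∈ l, IsExperiment ν) (c : List (Fin 2) → ℝ) :
    risk (nextLevel κ d ν :: l) c =
      ∑' k, ENNReal.ofReal (poissonWeight d k) *
        risk (List.replicate k ν ++ l) (pushRoot κ k c) := by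
  have hmeas : Measurable fun ℓ : Fin 2 → ℝ => risk l (fun xs => ∑ x, ℓ x * c (x :: xs)) := by
    refine (measurable_risk l fun ν h => ?_).comp (measurable_pi_lambda _ fun xs => ?_)
    · have := (hl ν h).finite
      infer_instance
    · fun_prop
  rw [risk, nextLevel, lintegral_map hmeas measurable_likPair, lintegral_compoundPoisson]
  refine tsum_congr fun k => ?_
  have := risk_replicate_append hκ hκ1 hν hl k (fun _ => 1) c
  simp only [one_mul] at this
  rw [← this]
  rfl

end SBM

namespace SBM
open scoped ENNReal

/-! ### Signed mixtures observed through independent Bernoulli variables. -/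

section Observation

variable {Ω α : Type*} [Fintype Ω] [DecidableEq α]

/-- Likelihood of observing exactly the set `g` of successes among the independent Bernoulli
variables indexed by `E`. -/
noncomputable def obsLik (q : α → Ω → ℝ) (E g : Finset α) (X : Ω) : ℝ :=
  (∏ e ∈ g, q e X) * ∏ e ∈ E \ g, (1 - q e X)

/-- Total mass of the signed law of the observation when the hidden variable has the signed
law `C`. -/
noncomputable def obsNorm (q : α → Ω → ℝ) (E : Finset α) (C : Ω → ℝ) : ℝ :=
  ∑ g ∈ E.powerset, |∑ X, C X * obsLik q E g X|

variable {q : α → Ω → ℝ} {E : Finset α}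

omit [Fintype Ω] in
lemma sum_obsLik (q : α → Ω → ℝ) (E : Finset α) (X : Ω) :
    ∑ g ∈ E.powerset, obsLik q E g X = 1 := by
  unfold obsLik
  rw [← Finset.prod_add]
  simp

omit [Fintype Ω] in
lemma obsLik_nonneg (h0 : ∀ e ∈ E, ∀ X, 0 ≤ q e X) (h1 : ∀ e ∈ E, ∀ X, q e X ≤ 1)
    {g : Finset α} (hg : g ⊆ E) (X : Ω) : 0 ≤ obsLik q E g X :=
  mul_nonneg (Finset.prod_nonneg fun e he => h0 e (hg he) X)
    (Finset.prod_nonneg fun e he => sub_nonneg.2 (h1 e (Finset.mem_sdiff.1 he).1 X))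

/-- A Markov kernel contracts the `L¹` norm of signed measures. -/
lemma obsNorm_le_sum_abs (h0 : ∀ e ∈ E, ∀ X, 0 ≤ q e X) (h1 : ∀ e ∈ E, ∀ X, q e X ≤ 1)
    (C : Ω → ℝ) : obsNorm q E C ≤ ∑ X, |C X| := by
  calc obsNorm q E C ≤ ∑ g ∈ E.powerset, ∑ X, |C X| * obsLik q E g X := by
        refine Finset.sum_le_sum fun g hg => (Finset.abs_sum_le_sum_abs _ _).trans
          (Finset.sum_le_sum fun X _ => ?_)
        rw [abs_mul, abs_of_nonneg (obsLik_nonneg h0 h1 (Finset.mem_powerset.1 hg) X)]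
    _ = ∑ X, |C X| := by
        rw [Finset.sum_comm]
        refine Finset.sum_congr rfl fun X _ => ?_
        rw [← Finset.mul_sum, sum_obsLik, mul_one]

lemma obsNorm_add_le (q : α → Ω → ℝ) (E : Finset α) (C C' : Ω → ℝ) :
    obsNorm q E (fun X => C X + C' X) ≤ obsNorm q E C + obsNorm q E C' := by
  unfold obsNorm
  rw [← Finset.sum_add_distrib]
  refine Finset.sum_le_sum fun g _ => ?_
  simp_rw [add_mul, Finset.sum_add_distrib]
  exact abs_add_le _ _

lemma obsNorm_le_add_sum_abs_sub (h0 : ∀ e ∈ E, ∀ X, 0 ≤ q e X) (h1 : ∀ e ∈ E, ∀ X, q e X ≤ 1)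
    (C C' : Ω → ℝ) : obsNorm q E C ≤ obsNorm q E C' + ∑ X, |C X - C' X| := by
  have h := obsNorm_add_le q E C' (fun X => C X - C' X)
  simp only [add_sub_cancel] at h
  exact h.trans (add_le_add_right (obsNorm_le_sum_abs h0 h1 _) _)

lemma obsNorm_mul_left {r : ℝ} (hr : 0 ≤ r) (q : α → Ω → ℝ) (E : Finset α) (C : Ω → ℝ) :
    obsNorm q E (fun X => r * C X) = r * obsNorm q E C := by
  unfold obsNorm
  rw [Finset.mul_sum]
  refine Finset.sum_congr rfl fun g _ => ?_
  simp_rw [mul_assoc, ← Finset.mul_sum]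
  rw [abs_mul, abs_of_nonneg hr]

lemma obsNorm_insert {a : α} (ha : a ∉ E) (C : Ω → ℝ) :
    obsNorm q (insert a E) C =
      obsNorm q E (fun X => C X * (1 - q a X)) + obsNorm q E (fun X => C X * q a X) := by
  unfold obsNorm
  rw [Finset.sum_powerset_insert ha]
  congr 1
  · refine Finset.sum_congr rfl fun g hg => ?_
    have hag : a ∉ g := fun h => ha (Finset.mem_powerset.1 hg h)
    congr 1
    refine Finset.sum_congr rfl fun X _ => ?_
    rw [obsLik, obsLik, Finset.insert_sdiff_of_notMem _ hag, Finset.prod_insert (by simp [ha])]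
    ring
  · refine Finset.sum_congr rfl fun g hg => ?_
    have hag : a ∉ g := fun h => ha (Finset.mem_powerset.1 hg h)
    congr 1
    refine Finset.sum_congr rfl fun X _ => ?_
    rw [obsLik, obsLik, Finset.insert_sdiff_insert, Finset.prod_insert hag,
      Finset.sdiff_insert_of_notMem ha]
    ring

/-- If the additional variable fails, the coefficients change by a relative amount at most `δ`; if
it succeeds, the branch has mass at most `δ` times the total. Hence `2 * δ` times the mass per
variable. -/
lemma obsNorm_union_le (h0 : ∀ e, ∀ X, 0 ≤ q e X) (h1 : ∀ e, ∀ X, q e X ≤ 1) {δ : ℝ}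
    (hδ : ∀ e X, q e X ≤ δ) {A : Finset α} (hA : Disjoint E A) (C : Ω → ℝ) :
    obsNorm q (E ∪ A) C ≤ obsNorm q E C + A.card * (2 * δ * ∑ X, |C X|) := by
  induction A using Finset.induction_on with
  | empty => simp
  | insert a A ha ih =>
    rw [Finset.disjoint_insert_right] at hA
    have haE : a ∉ E ∪ A := by simp [ha, hA.1]
    have key : ∑ X, |C X * q a X| ≤ δ * ∑ X, |C X| := by
      rw [Finset.mul_sum]
      refine Finset.sum_le_sum fun X _ => ?_
      rw [abs_mul, abs_of_nonneg (h0 a X), mul_comm]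
      exact mul_le_mul_of_nonneg_right (hδ a X) (abs_nonneg _)
    rw [Finset.union_insert, obsNorm_insert haE, Finset.card_insert_of_notMem ha]
    have e1 := obsNorm_le_add_sum_abs_sub (E := E ∪ A) (fun e _ => h0 e) (fun e _ => h1 e)
      (fun X => C X * (1 - q a X)) C
    have e2 := obsNorm_le_sum_abs (E := E ∪ A) (fun e _ => h0 e) (fun e _ => h1 e)
      (fun X => C X * q a X)
    have e3 : ∑ X, |C X * (1 - q a X) - C X| = ∑ X, |C X * q a X| := by
      refine Finset.sum_congr rfl fun X _ => ?_
      rw [← abs_neg]; congr 1; ring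
    have := ih hA.2
    push_cast
    linarith

lemma obsNorm_union_eq_sum {A : Finset α} (hA : Disjoint E A) (C : Ω → ℝ) :
    obsNorm q (E ∪ A) C =
      ∑ S ∈ A.powerset, obsNorm q E (fun X => C X * obsLik q A S X) := by
  induction A using Finset.induction_on generalizing C with
  | empty => simp [obsLik]
  | insert a A ha ih =>
    rw [Finset.disjoint_insert_right] at hA
    have haE : a ∉ E ∪ A := by simp [ha, hA.1]
    rw [Finset.union_insert, obsNorm_insert haE, ih hA.2, ih hA.2, Finset.sum_powerset_insert ha]
    congr 1
    · refine Finset.sum_congr rfl fun g hg => ?_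
      have hag : a ∉ g := fun h => ha (Finset.mem_powerset.1 hg h)
      congr 1
      ext X
      rw [obsLik, obsLik, Finset.insert_sdiff_of_notMem _ hag, Finset.prod_insert (by simp [ha])]
      ring
    · refine Finset.sum_congr rfl fun g hg => ?_
      have hag : a ∉ g := fun h => ha (Finset.mem_powerset.1 hg h)
      congr 1
      ext X
      rw [obsLik, obsLik, Finset.insert_sdiff_insert, Finset.prod_insert hag,
        Finset.sdiff_insert_of_notMem ha]
      ring

end Observation

/-! ### Labellings, marginals, and laws with distinguished roots. -/

section Labels

variable {V : Type*} [Fintype V] [DecidableEq V]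

/-- Shifting the label at `v` by a fixed element of `Fin 2` permutes the labellings, so each of the
two shifts yields the full sum. -/
lemma sum_sum_update (v : V) (f : (V → Fin 2) → ℝ) :
    ∑ X, ∑ x, f (Function.update X v x) = 2 * ∑ X, f X := by
  have h : ∀ y : Fin 2, ∑ X : V → Fin 2, f (Function.update X v (X v + y)) = ∑ X, f X := by
    intro y
    refine Fintype.sum_bijective (fun X => Function.update X v (X v + y)) ?_ _ _ fun X => rfl
    refine Function.Involutive.bijective fun X => ?_
    have : y + y = 0 := by fin_cases y <;> rfl
    simp [add_assoc, this]
  have h2 : ∀ X : V → Fin 2, ∑ x, f (Function.update X v x) =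
      ∑ y, f (Function.update X v (X v + y)) := fun X =>
    (Fintype.sum_bijective (fun y => X v + y) (AddGroup.addLeft_bijective _) _ _ fun y => rfl).symm
  simp_rw [h2]
  rw [Finset.sum_comm]
  simp_rw [h]
  simp

lemma sum_mul_congr_of_marginal (v : V) {C C' L : (V → Fin 2) → ℝ}
    (hL : ∀ X x, L (Function.update X v x) = L X)
    (h : ∀ X, ∑ x, C (Function.update X v x) = ∑ x, C' (Function.update X v x)) :
    ∑ X, C X * L X = ∑ X, C' X * L X := by
  have h1 := sum_sum_update v fun X => C X * L X
  have h2 := sum_sum_update v fun X => C' X * L X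
  simp only [hL, ← Finset.sum_mul, h] at h1 h2
  linarith

/-- Once no remaining pair involves `v`, only the sum over its label matters. This is how an exposed
root is eliminated. -/
lemma obsNorm_congr_of_marginal {α : Type*} [DecidableEq α] (v : V) {q : α → (V → Fin 2) → ℝ}
    {E : Finset α} {C C' : (V → Fin 2) → ℝ}
    (hq : ∀ e ∈ E, ∀ X x, q e (Function.update X v x) = q e X)
    (h : ∀ X, ∑ x, C (Function.update X v x) = ∑ x, C' (Function.update X v x)) :
    obsNorm q E C = obsNorm q E C' := by
  refine Finset.sum_congr rfl fun g hg => ?_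
  congr 1
  refine sum_mul_congr_of_marginal v (fun X x => ?_) h
  unfold obsLik
  congr 1
  · exact Finset.prod_congr rfl fun e he => hq e (Finset.mem_powerset.1 hg he) X x
  · exact Finset.prod_congr rfl fun e he => by rw [hq e (Finset.mem_sdiff.1 he).1]

lemma sum_prod_labels (f : V → Fin 2 → ℝ) :
    ∑ X : V → Fin 2, ∏ u, f u (X u) = ∏ u, ∑ x, f u x := by
  rw [Finset.prod_univ_sum, Fintype.piFinset_univ]

/-- The signed law on labellings for which the labels outside `rs` are independent with laws `w`
and the list of labels of `rs` is weighted by `c`. -/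
noncomputable def rootedLaw (w : V → Fin 2 → ℝ) (rs : List V) (c : List (Fin 2) → ℝ)
    (X : V → Fin 2) : ℝ :=
  c (rs.map X) * ∏ u ∈ Finset.univ \ rs.toFinset, w u (X u)

/-- Edge probabilities `δ * A` between vertices labelled by `X`. -/
noncomputable def edgeProb (δ : ℝ) (A : Sym2 (Fin 2) → ℝ) (e : Sym2 V) (X : V → Fin 2) : ℝ :=
  δ * A (e.map X)

/-- The edges of the complete graph on `U`. -/
def innerEdges (U : Finset V) : Finset (Sym2 V) := U.sym2.filter fun e => ¬ e.IsDiag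

omit [Fintype V] in
lemma innerEdges_insert {v : V} {U : Finset V} (hv : v ∉ U) :
    innerEdges (insert v U) = innerEdges U ∪ U.image fun u => s(v, u) := by
  ext e
  induction e with
  | h x y =>
    simp only [innerEdges, Finset.mem_filter, Finset.mk_mem_sym2_iff, Finset.mem_insert,
      Sym2.mk_isDiag_iff, Finset.mem_union, Finset.mem_image, Sym2.eq_iff]
    constructor
    · rintro ⟨⟨rfl | hx, rfl | hy⟩, hxy⟩
      · exact absurd rfl hxy
      · exact Or.inr ⟨y, hy, Or.inl ⟨rfl, rfl⟩⟩
      · exact Or.inr ⟨x, hx, Or.inr ⟨rfl, rfl⟩⟩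
      · exact Or.inl ⟨⟨hx, hy⟩, hxy⟩
    · rintro (⟨⟨hx, hy⟩, hxy⟩ | ⟨u, hu, ⟨rfl, rfl⟩ | ⟨rfl, rfl⟩⟩)
      · exact ⟨⟨Or.inr hx, Or.inr hy⟩, hxy⟩
      · exact ⟨⟨Or.inl rfl, Or.inr hu⟩, fun h => hv (h ▸ hu)⟩
      · exact ⟨⟨Or.inr hu, Or.inl rfl⟩, fun h => hv (h ▸ hu)⟩

omit [Fintype V] in
lemma mem_of_mem_innerEdges {U : Finset V} {e : Sym2 V} (he : e ∈ innerEdges U) {u : V}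
    (hu : u ∈ e) : u ∈ U :=
  Finset.mem_sym2_iff.1 (Finset.mem_filter.1 he).1 u hu

omit [Fintype V] in
lemma disjoint_innerEdges_image {v : V} {U : Finset V} (hv : v ∉ U) (B : Finset V) :
    Disjoint (innerEdges U) (B.image fun u => s(v, u)) := by
  rw [Finset.disjoint_left]
  intro e he h
  obtain ⟨u, -, rfl⟩ := Finset.mem_image.1 h
  exact hv (mem_of_mem_innerEdges he (Sym2.mem_mk_left v u))

omit [Fintype V] in
lemma edgeProb_update {δ : ℝ} {A : Sym2 (Fin 2) → ℝ} {v : V} {e : Sym2 V} (hv : v ∉ e)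
    (X : V → Fin 2) (x : Fin 2) : edgeProb δ A e (Function.update X v x) = edgeProb δ A e X := by
  unfold edgeProb
  congr 2
  refine Sym2.map_congr fun u hu => ?_
  rw [Function.update_of_ne]
  rintro rfl
  exact hv hu

omit [Fintype V] [DecidableEq V] in
lemma injective_sym2_mk (v : V) : Function.Injective fun u : V => s(v, u) := fun a b h => by
  exact Sym2.congr_right.1 h

lemma sum_abs_rootedLaw_le {w : V → Fin 2 → ℝ} (hw0 : ∀ u x, 0 ≤ w u x)
    (hw1 : ∀ u, ∑ x, w u x = 1) (rs : List V) {c : List (Fin 2) → ℝ} {B : ℝ}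
    (hc : ∀ xs, |c xs| ≤ B) :
    ∑ X, |rootedLaw w rs c X| ≤ B * 2 ^ rs.length := by
  have hB : 0 ≤ B := (abs_nonneg _).trans (hc [])
  have hprod : ∑ X : V → Fin 2, ∏ u ∈ Finset.univ \ rs.toFinset, w u (X u) =
      2 ^ rs.toFinset.card := by
    have h := sum_prod_labels fun u x => if u ∈ rs.toFinset then (1 : ℝ) else w u x
    have h2 : ∀ X : V → Fin 2, ∏ u, (if u ∈ rs.toFinset then (1 : ℝ) else w u (X u)) =
        ∏ u ∈ Finset.univ \ rs.toFinset, w u (X u) := fun X => by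
      rw [Finset.prod_ite, Finset.prod_const_one, one_mul]
      congr 1
      ext u; simp
    have h3 : ∀ u : V, ∑ x, (if u ∈ rs.toFinset then (1 : ℝ) else w u x) =
        if u ∈ rs.toFinset then 2 else 1 := fun u => by
      split_ifs
      · simp
      · exact hw1 u
    simp_rw [h2, h3] at h
    rw [h, Finset.prod_ite, Finset.prod_const, Finset.prod_const_one, mul_one]
    congr 2
    ext u; simp
  calc ∑ X, |rootedLaw w rs c X| ≤ ∑ X : V → Fin 2, B * ∏ u ∈ Finset.univ \ rs.toFinset, w u (X u) := by
        refine Finset.sum_le_sum fun X _ => ?_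
        have hp : 0 ≤ ∏ u ∈ Finset.univ \ rs.toFinset, w u (X u) :=
          Finset.prod_nonneg fun u _ => hw0 u _
        rw [rootedLaw, abs_mul, abs_of_nonneg hp]
        exact mul_le_mul_of_nonneg_right (hc _) hp
    _ = B * 2 ^ rs.toFinset.card := by rw [← Finset.mul_sum, hprod]
    _ ≤ B * 2 ^ rs.length := by
        gcongr
        · norm_num
        · exact List.toFinset_card_le rs

end Labels

end SBM

/-! ### Absent edges are uninformative when all mean degrees agree. -/

namespace SBM
open scoped ENNReal

/-- Admissible parameters of a block model in which all vertices have the same mean degree. -/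
structure Admissible (p d : ℝ) (A : Sym2 (Fin 2) → ℝ) : Prop where
  p_pos : 0 < p
  p_lt_one : p < 1
  d_pos : 0 < d
  pos : ∀ e, 0 < A e
  row : ∀ x, ∑ y, A s(x, y) * labelProb p y = 1

/-- Transition probabilities from the label of a vertex to the labels of its neighbours. -/
noncomputable def transition (p : ℝ) (A : Sym2 (Fin 2) → ℝ) (x y : Fin 2) : ℝ :=
  A s(x, y) * labelProb p y

lemma labelProb_pos {p : ℝ} (h0 : 0 < p) (h1 : p < 1) (x : Fin 2) : 0 < labelProb p x := by
  unfold labelProb; split_ifs <;> linarith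

lemma sum_labelProb (p : ℝ) : ∑ x, labelProb p x = 1 := by
  simp [labelProb]

section Exposure

variable {p d : ℝ} {A : Sym2 (Fin 2) → ℝ}

lemma Admissible.transition_pos (h : Admissible p d A) (x y : Fin 2) : 0 < transition p A x y :=
  mul_pos (h.pos _) (labelProb_pos h.p_pos h.p_lt_one y)

lemma Admissible.transition_le_one (h : Admissible p d A) (x y : Fin 2) :
    transition p A x y ≤ 1 := by
  rw [← h.row x]
  exact Finset.single_le_sum (f := fun y => A s(x, y) * labelProb p y)
    (fun y _ => (h.transition_pos x y).le) (Finset.mem_univ y)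

variable {V : Type*} [Fintype V] [DecidableEq V]

lemma sum_prod_mul_prod_pair {w : V → Fin 2 → ℝ} (hw1 : ∀ u, ∑ x, w u x = 1) {v : V}
    {F : Finset V} (hv : v ∉ F) (h : Fin 2 → Fin 2 → ℝ) :
    ∑ X : V → Fin 2, (∏ u, w u (X u)) * ∏ u ∈ F, h (X v) (X u) =
      ∑ x, w v x * ∏ u ∈ F, ∑ y, w u y * h x y := by
  -- The indicator at `v` fixes its label to `x`, after which the remaining labels are independent
  -- and the sum factorises.
  set g : Fin 2 → V → Fin 2 → ℝ := fun x u y =>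
    if u = v then (if y = x then w v y else 0) else if u ∈ F then w u y * h x y else w u y
  have key : ∀ X : V → Fin 2, (∏ u, w u (X u)) * ∏ u ∈ F, h (X v) (X u) =
      ∑ x, ∏ u, g x u (X u) := by
    intro X
    rw [Finset.sum_eq_single (X v)]
    · rw [← Finset.prod_subset (Finset.subset_univ F)
        (f := fun u => if u ∈ F then h (X v) (X u) else 1) (fun u _ hu => by simp [hu]) |>.symm.trans
        (Finset.prod_congr rfl fun u hu => by simp [hu]), ← Finset.prod_mul_distrib]
      refine Finset.prod_congr rfl fun u _ => ?_
      by_cases huv : u = v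
      · subst huv; simp [g, hv]
      · by_cases huF : u ∈ F <;> simp [g, huv, huF]
    · intro x _ hx
      refine Finset.prod_eq_zero (Finset.mem_univ v) ?_
      simp [g, hx.symm]
    · simp
  simp_rw [key]
  rw [Finset.sum_comm]
  refine Finset.sum_congr rfl fun x _ => ?_
  rw [sum_prod_labels, ← Finset.mul_prod_erase _ _ (Finset.mem_univ v)]
  congr 1
  · simp [g]
  · have hF : F ⊆ Finset.univ.erase v := fun u hu =>
      Finset.mem_erase.2 ⟨fun e => hv (e ▸ hu), Finset.mem_univ u⟩
    rw [← Finset.prod_subset hF]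
    · refine Finset.prod_congr rfl fun u hu => Finset.sum_congr rfl fun y _ => ?_
      have huv : u ≠ v := fun e => hv (e ▸ hu)
      simp [g, huv, hu]
    · intro u hu huF
      have huv : u ≠ v := (Finset.mem_erase.1 hu).1
      simp [g, huv, huF, hw1]

lemma sum_powerset_sum_prod {w : V → Fin 2 → ℝ} (hw1 : ∀ u, ∑ x, w u x = 1) {v : V}
    {F : Finset V} (hv : v ∉ F) (f₀ f₁ : Fin 2 → Fin 2 → ℝ) :
    ∑ S ∈ F.powerset, ∑ X : V → Fin 2, (∏ u, w u (X u)) *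
        ((∏ u ∈ S, f₁ (X v) (X u)) * ∏ u ∈ F \ S, f₀ (X v) (X u)) =
      ∑ x, w v x * ∏ u ∈ F, ∑ y, w u y * (f₁ x y + f₀ x y) := by
  rw [Finset.sum_comm, ← sum_prod_mul_prod_pair hw1 hv]
  refine Finset.sum_congr rfl fun X _ => ?_
  rw [← Finset.mul_sum, ← Finset.prod_add]

/-- The absence of edges from `v` to the fresh vertices carries almost no information on their
labels. -/
lemma sum_abs_nonEdge_sub_le (h : Admissible p d A) {δ K : ℝ} (hδ0 : 0 ≤ δ) (hδ1 : δ ≤ 1 / 2)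
    (hK : ∀ e, A e ≤ K) {w : V → Fin 2 → ℝ} (hw0 : ∀ u x, 0 ≤ w u x)
    (hw1 : ∀ u, ∑ x, w u x = 1) {v : V} {F : Finset V} (hv : v ∉ F)
    (hF : ∀ u ∈ F, w u = labelProb p) {η : ℝ} (hη : 0 < η) :
    ∑ S ∈ F.powerset, ∑ X : V → Fin 2, (∏ u, w u (X u)) * ((∏ u ∈ S, δ * A s(X v, X u)) *
        |(∏ u ∈ F \ S, (1 - δ * A s(X v, X u))) - ∏ _u ∈ F \ S, (1 - δ)|) ≤
      η / 2 + ((1 + 2 * K * δ ^ 2) ^ F.card - 1) / (2 * η) := by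
  have hδ' : 0 < 1 - δ := by linarith
  -- Under the reference law `Q`, in which absent edges have the label-free weight `1 - δ`, the
  -- product of the `ρ` is a density. The row identity gives both laws mass one; what remains is a
  -- second moment bound.
  set ρ : Fin 2 → Fin 2 → ℝ := fun x y => (1 - δ * A s(x, y)) / (1 - δ)
  set Q : (V → Fin 2) → Finset V → ℝ := fun X S =>
    (∏ u, w u (X u)) * ((∏ u ∈ S, δ * A s(X v, X u)) * ∏ _u ∈ F \ S, (1 - δ))
  have hQ0 : ∀ X S, 0 ≤ Q X S := fun X S =>
    mul_nonneg (Finset.prod_nonneg fun u _ => hw0 u _) (mul_nonneg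
      (Finset.prod_nonneg fun _ _ => mul_nonneg hδ0 (h.pos _).le)
      (Finset.prod_nonneg fun _ _ => hδ'.le))
  have hrow : ∀ x, ∀ u ∈ F, ∑ y, w u y * A s(x, y) = 1 := fun x u hu => by
    rw [hF u hu, ← h.row x]
    exact Finset.sum_congr rfl fun y _ => mul_comm _ _
  have hone : ∀ u ∈ F, ∑ y, w u y = 1 := fun u _ => hw1 u
  have h0 : ∑ S ∈ F.powerset, ∑ X, Q X S = 1 := by
    rw [sum_powerset_sum_prod hw1 hv (fun _ _ => 1 - δ) (fun x y => δ * A s(x, y))]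
    refine Eq.trans ?_ (hw1 v)
    refine Finset.sum_congr rfl fun x _ => ?_
    rw [Finset.prod_eq_one, mul_one]
    intro u hu
    have h1 := hrow x u hu
    have h2 := hone u hu
    simp only [Fin.sum_univ_two] at h1 h2 ⊢
    linear_combination δ * h1 + (1 - δ) * h2
  have h1 : ∑ S ∈ F.powerset, ∑ X, Q X S * ∏ u ∈ F \ S, ρ (X v) (X u) = 1 := by
    have e : ∀ S X, Q X S * ∏ u ∈ F \ S, ρ (X v) (X u) = (∏ u, w u (X u)) *
        ((∏ u ∈ S, δ * A s(X v, X u)) * ∏ u ∈ F \ S, (1 - δ * A s(X v, X u))) := by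
      intro S X
      simp only [Q]
      rw [mul_assoc, mul_assoc, ← Finset.prod_mul_distrib]
      congr 2
      exact Finset.prod_congr rfl fun u _ => mul_div_cancel₀ _ hδ'.ne'
    simp_rw [e]
    rw [sum_powerset_sum_prod hw1 hv (fun x y => 1 - δ * A s(x, y)) (fun x y => δ * A s(x, y))]
    refine Eq.trans ?_ (hw1 v)
    refine Finset.sum_congr rfl fun x _ => ?_
    simp only [add_sub_cancel, mul_one]
    rw [Finset.prod_eq_one hone, mul_one]
  have h2 : ∑ S ∈ F.powerset, ∑ X, Q X S * (∏ u ∈ F \ S, ρ (X v) (X u)) ^ 2 ≤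
      (1 + 2 * K * δ ^ 2) ^ F.card := by
    have e : ∀ S X, Q X S * (∏ u ∈ F \ S, ρ (X v) (X u)) ^ 2 = (∏ u, w u (X u)) *
        ((∏ u ∈ S, δ * A s(X v, X u)) *
          ∏ u ∈ F \ S, (fun x y => (1 - δ * A s(x, y)) ^ 2 / (1 - δ)) (X v) (X u)) := by
      intro S X
      simp only [Q]
      rw [mul_assoc, mul_assoc, ← Finset.prod_pow, ← Finset.prod_mul_distrib]
      congr 2
      refine Finset.prod_congr rfl fun u _ => ?_
      simp only [ρ]
      field_simp
    simp_rw [e]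
    rw [sum_powerset_sum_prod hw1 hv (fun x y => (1 - δ * A s(x, y)) ^ 2 / (1 - δ))
      (fun x y => δ * A s(x, y))]
    calc ∑ x, w v x * ∏ u ∈ F, ∑ y, w u y *
          (δ * A s(x, y) + (1 - δ * A s(x, y)) ^ 2 / (1 - δ))
        ≤ ∑ x, w v x * (1 + 2 * K * δ ^ 2) ^ F.card := by
          refine Finset.sum_le_sum fun x _ => mul_le_mul_of_nonneg_left ?_ (hw0 v x)
          rw [← Finset.prod_const]
          refine Finset.prod_le_prod (fun u _ => Finset.sum_nonneg fun y _ => mul_nonneg (hw0 u y)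
            (add_nonneg (mul_nonneg hδ0 (h.pos _).le) (div_nonneg (sq_nonneg _) hδ'.le)))
            fun u hu => ?_
          have r1 := hrow x u hu
          have r2 := hone u hu
          have r3 : ∑ y, w u y * A s(x, y) ^ 2 ≤ K := by
            calc ∑ y, w u y * A s(x, y) ^ 2 ≤ ∑ y, K * (w u y * A s(x, y)) := by
                  refine Finset.sum_le_sum fun y _ => ?_
                  have := mul_nonneg (mul_nonneg (hw0 u y) (h.pos s(x, y)).le)
                    (sub_nonneg.2 (hK s(x, y)))
                  linarith
              _ = K := by rw [← Finset.mul_sum, r1, mul_one]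
          -- The terms linear in `δ` cancel by the row identity, so each vertex contributes only
          -- `O(δ ^ 2)`.
          have e2 : ∑ y, w u y * (δ * A s(x, y) + (1 - δ * A s(x, y)) ^ 2 / (1 - δ)) =
              1 + δ ^ 2 * ((∑ y, w u y * A s(x, y) ^ 2) - 1) / (1 - δ) := by
            simp only [Fin.sum_univ_two] at r1 r2 ⊢
            field_simp
            linear_combination (δ * (1 - δ) - 2 * δ) * r1 + r2
          rw [e2]
          have hK0 : 0 ≤ K := (h.pos s(0, 0)).le.trans (hK _)
          have : δ ^ 2 * ((∑ y, w u y * A s(x, y) ^ 2) - 1) / (1 - δ) ≤ 2 * K * δ ^ 2 := by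
            rw [div_le_iff₀ hδ']
            have : 0 ≤ δ ^ 2 := sq_nonneg δ
            have t1 : δ ^ 2 * ((∑ y, w u y * A s(x, y) ^ 2) - 1) ≤ δ ^ 2 * K :=
              mul_le_mul_of_nonneg_left (by linarith) this
            have t2 : 0 ≤ δ ^ 2 * K * (1 - 2 * δ) :=
              mul_nonneg (mul_nonneg this hK0) (by linarith)
            linarith
          linarith
      _ = (1 + 2 * K * δ ^ 2) ^ F.card := by rw [← Finset.sum_mul, hw1, one_mul]
  have hpt : ∀ S X, (∏ u, w u (X u)) * ((∏ u ∈ S, δ * A s(X v, X u)) *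
        |(∏ u ∈ F \ S, (1 - δ * A s(X v, X u))) - ∏ _u ∈ F \ S, (1 - δ)|) ≤
      η / 2 * Q X S + (2 * η)⁻¹ * (Q X S * (∏ u ∈ F \ S, ρ (X v) (X u)) ^ 2
        - 2 * (Q X S * ∏ u ∈ F \ S, ρ (X v) (X u)) + Q X S) := by
    intro S X
    set R := ∏ u ∈ F \ S, ρ (X v) (X u)
    have e : (∏ u, w u (X u)) * ((∏ u ∈ S, δ * A s(X v, X u)) *
        |(∏ u ∈ F \ S, (1 - δ * A s(X v, X u))) - ∏ _u ∈ F \ S, (1 - δ)|) = Q X S * |R - 1| := by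
      have : (∏ u ∈ F \ S, (1 - δ * A s(X v, X u))) = (∏ _u ∈ F \ S, (1 - δ)) * R := by
        rw [← Finset.prod_mul_distrib]
        exact Finset.prod_congr rfl fun u _ => (mul_div_cancel₀ _ hδ'.ne').symm
      rw [this, ← mul_sub_one, abs_mul, abs_of_nonneg (Finset.prod_nonneg fun u _ => hδ'.le)]
      ring
    -- The arithmetic-geometric mean inequality replaces Cauchy-Schwarz, so that only moments of `R`
    -- are needed.
    have hR : |R - 1| ≤ η / 2 + (2 * η)⁻¹ * (R - 1) ^ 2 := by
      rw [← sq_abs (R - 1)]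
      have : 0 ≤ (|R - 1| - η) ^ 2 / (2 * η) := by positivity
      have e : η / 2 + (2 * η)⁻¹ * |R - 1| ^ 2 - |R - 1| = (|R - 1| - η) ^ 2 / (2 * η) := by
        field_simp; ring
      linarith
    rw [e]
    calc Q X S * |R - 1| ≤ Q X S * (η / 2 + (2 * η)⁻¹ * (R - 1) ^ 2) :=
          mul_le_mul_of_nonneg_left hR (hQ0 X S)
      _ = _ := by ring
  calc _ ≤ _ := Finset.sum_le_sum fun S _ => Finset.sum_le_sum fun X _ => hpt S X
    _ = η / 2 * (∑ S ∈ F.powerset, ∑ X, Q X S) + (2 * η)⁻¹ *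
        ((∑ S ∈ F.powerset, ∑ X, Q X S * (∏ u ∈ F \ S, ρ (X v) (X u)) ^ 2) -
          2 * (∑ S ∈ F.powerset, ∑ X, Q X S * ∏ u ∈ F \ S, ρ (X v) (X u)) +
          ∑ S ∈ F.powerset, ∑ X, Q X S) := by
        simp only [Finset.sum_add_distrib, Finset.sum_sub_distrib, ← Finset.mul_sum]
    _ ≤ _ := by
        rw [h0, h1, div_eq_inv_mul _ (2 * η)]
        have := mul_le_mul_of_nonneg_left h2 (show 0 ≤ (2 * η)⁻¹ by positivity)
        linarith

end Exposure

end SBM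

namespace SBM
open scoped ENNReal

/-! ### Exposing all edges at one root. -/

section RootExposure

variable {p d : ℝ} {A : Sym2 (Fin 2) → ℝ} {V : Type*} [Fintype V] [DecidableEq V]

omit [Fintype V] in
lemma obsLik_image_star {q : Sym2 V → (V → Fin 2) → ℝ} (v : V) {F S : Finset V}
    (X : V → Fin 2) :
    obsLik q (F.image fun u => s(v, u)) (S.image fun u => s(v, u)) X =
      (∏ u ∈ S, q s(v, u) X) * ∏ u ∈ F \ S, (1 - q s(v, u) X) := by
  rw [obsLik, ← Finset.image_sdiff _ _ (injective_sym2_mk v),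
    Finset.prod_image (injective_sym2_mk v).injOn, Finset.prod_image (injective_sym2_mk v).injOn]

/-- Each neighbour `u ∈ S` brings an edge factor and a label weight, whose product is the transition
probability. On the right `v` is an ordinary vertex again, with law `w v` of mass one, and the
vertices of `S` have become roots. -/
lemma sum_update_rootedLaw {δ : ℝ} {w : V → Fin 2 → ℝ} (hw1 : ∀ u, ∑ x, w u x = 1) {v : V}
    {rs : List V} (hv : v ∉ rs) {S : Finset V} (hvS : v ∉ S) (hS : ∀ u ∈ S, u ∉ rs)
    (hP : ∀ u ∈ S, w u = labelProb p) (c : List (Fin 2) → ℝ) (X : V → Fin 2) :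
    ∑ x, rootedLaw w (v :: rs) c (Function.update X v x) *
        ∏ u ∈ S, δ * A s((Function.update X v x) v, (Function.update X v x) u) =
      ∑ x, δ ^ S.card * rootedLaw w (S.toList ++ rs) (pushRoot (transition p A) S.card c)
        (Function.update X v x) := by
  have hne : ∀ u ∈ S, u ≠ v := fun u hu e => hvS (e ▸ hu)
  have hrs : ∀ x, rs.map (Function.update X v x) = rs.map X := fun x =>
    List.map_congr_left fun u hu => Function.update_of_ne (ne_of_mem_of_not_mem hu hv) _ _
  have hSl : ∀ x, S.toList.map (Function.update X v x) = S.toList.map X := fun x =>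
    List.map_congr_left fun u hu => Function.update_of_ne (hne u (Finset.mem_toList.1 hu)) _ _
  set W := (Finset.univ \ (S.toList ++ rs).toFinset).erase v
  have hvW : v ∈ Finset.univ \ (S.toList ++ rs).toFinset := by simp [hvS, hv]
  have e1 : ∀ x, ∏ u ∈ Finset.univ \ (S.toList ++ rs).toFinset, w u (Function.update X v x u) =
      w v x * ∏ u ∈ W, w u (X u) := fun x => by
    rw [← Finset.mul_prod_erase _ _ hvW, Function.update_self]
    congr 1
    exact Finset.prod_congr rfl fun u hu => by rw [Function.update_of_ne (Finset.ne_of_mem_erase hu)]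
  have e2 : ∀ x, ∏ u ∈ Finset.univ \ (v :: rs).toFinset, w u (Function.update X v x u) =
      (∏ u ∈ S, labelProb p (X u)) * ∏ u ∈ W, w u (X u) := fun x => by
    have hd : Disjoint S W := by
      rw [Finset.disjoint_left]; intro u hu; simp [W, hu]
    have hu : Finset.univ \ (v :: rs).toFinset = S ∪ W := by
      ext u
      simp only [Finset.mem_sdiff, Finset.mem_univ, true_and, List.mem_toFinset, List.mem_cons,
        not_or, Finset.mem_union, W, Finset.mem_erase, List.mem_append, Finset.mem_toList]
      by_cases hu : u ∈ S
      · simp [hu, hS u hu, hne u hu]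
      · simp [hu]
    rw [hu, Finset.prod_union hd]
    congr 1
    · exact Finset.prod_congr rfl fun u hu => by rw [Function.update_of_ne (hne u hu), hP u hu]
    · exact Finset.prod_congr rfl fun u hu => by
        rw [Function.update_of_ne (Finset.ne_of_mem_erase hu)]
  have e3 : ∀ x, ∏ u ∈ S, δ * A s((Function.update X v x) v, (Function.update X v x) u) =
      δ ^ S.card * ∏ u ∈ S, A s(x, X u) := fun x => by
    rw [← Finset.prod_const, ← Finset.prod_mul_distrib]
    exact Finset.prod_congr rfl fun u hu => by
      rw [Function.update_of_ne (hne u hu), Function.update_self]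
  have e4 : ∀ x, rootedLaw w (S.toList ++ rs) (pushRoot (transition p A) S.card c)
      (Function.update X v x) = w v x * ((∏ u ∈ W, w u (X u)) *
        ∑ y, (∏ u ∈ S, transition p A y (X u)) * c (y :: rs.map X)) := fun x => by
    have hl : (S.toList.map X).length = S.card := by simp
    rw [rootedLaw, e1, List.map_append, hSl, hrs, pushRoot, ← hl, List.take_left, List.drop_left]
    simp only [List.map_map, Function.comp_def, Finset.prod_map_toList]
    ring
  simp_rw [e4, ← Finset.mul_sum, ← Finset.sum_mul, hw1, one_mul, rootedLaw, List.map_cons, e2, hrs,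
    e3, Function.update_self, Finset.mul_sum]
  refine Finset.sum_congr rfl fun x _ => ?_
  have : ∏ u ∈ S, transition p A x (X u) =
      (∏ u ∈ S, A s(x, X u)) * ∏ u ∈ S, labelProb p (X u) := by
    rw [← Finset.prod_mul_distrib]; rfl
  rw [this]
  ring

/-- The signed root coefficients are dominated by a multiple of the uniform law on root labels, so
estimates stated for product probability laws apply. -/
lemma abs_rootedLaw_le {w : V → Fin 2 → ℝ} (hw0 : ∀ u x, 0 ≤ w u x) (rs : List V)
    {c : List (Fin 2) → ℝ} {B : ℝ} (hc : ∀ xs, |c xs| ≤ B) (X : V → Fin 2) :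
    |rootedLaw w rs c X| ≤ B * 2 ^ rs.length *
      ∏ u, (if u ∈ rs then (fun _ => 1 / 2) else w u) (X u) := by
  have hB : 0 ≤ B := (abs_nonneg _).trans (hc [])
  have e : ∏ u, (if u ∈ rs then (fun _ => 1 / 2) else w u) (X u) =
      (∏ _u ∈ rs.toFinset, (1 / 2 : ℝ)) * ∏ u ∈ Finset.univ \ rs.toFinset, w u (X u) := by
    rw [← Finset.prod_sdiff (Finset.subset_univ rs.toFinset), mul_comm]
    congr 1
    · exact Finset.prod_congr rfl fun u hu => by rw [if_pos (List.mem_toFinset.1 hu)]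
    · exact Finset.prod_congr rfl fun u hu => by
        rw [if_neg fun h => (Finset.mem_sdiff.1 hu).2 (List.mem_toFinset.2 h)]
  have hp : 0 ≤ ∏ u ∈ Finset.univ \ rs.toFinset, w u (X u) :=
    Finset.prod_nonneg fun u _ => hw0 u _
  rw [rootedLaw, abs_mul, abs_of_nonneg hp, e, Finset.prod_const, ← mul_assoc]
  refine mul_le_mul_of_nonneg_right ?_ hp
  have h1 : (1 : ℝ) ≤ 2 ^ rs.length * (1 / 2) ^ rs.toFinset.card := by
    have h2 : (2 : ℝ) ^ rs.toFinset.card ≤ 2 ^ rs.length :=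
      pow_le_pow_right₀ (by norm_num) (List.toFinset_card_le rs)
    calc (1 : ℝ) = 2 ^ rs.toFinset.card * (1 / 2) ^ rs.toFinset.card := by
          rw [← mul_pow]; norm_num
      _ ≤ _ := mul_le_mul_of_nonneg_right h2 (by positivity)
  calc |c (rs.map X)| ≤ B * 1 := by rw [mul_one]; exact hc _
    _ ≤ B * (2 ^ rs.length * (1 / 2) ^ rs.toFinset.card) := mul_le_mul_of_nonneg_left h1 hB
    _ = _ := by ring

/-- Exposing the edges at the first root. -/
lemma obsNorm_root_le (h : Admissible p d A) {δ K : ℝ} (hδ0 : 0 ≤ δ) (hδ1 : δ ≤ 1 / 2)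
    (hK : ∀ e, A e ≤ K) (hδK : δ * K ≤ 1) {w : V → Fin 2 → ℝ} (hw0 : ∀ u x, 0 ≤ w u x)
    (hw1 : ∀ u, ∑ x, w u x = 1) {v : V} {rs : List V} (hv : v ∉ rs) {U F : Finset V} (hvU : v ∉ U)
    (hFU : F ⊆ U) (hFrs : ∀ u ∈ F, u ∉ rs) (hF : ∀ u ∈ F, w u = labelProb p)
    {c : List (Fin 2) → ℝ} {B : ℝ} (hc : ∀ xs, |c xs| ≤ B) {η : ℝ} (hη : 0 < η) :
    obsNorm (edgeProb δ A) (innerEdges (insert v U)) (rootedLaw w (v :: rs) c) ≤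
      (U \ F).card * (2 * (δ * K) * (B * 2 ^ (rs.length + 1))) +
      B * 2 ^ (rs.length + 1) * (η / 2 + ((1 + 2 * K * δ ^ 2) ^ F.card - 1) / (2 * η)) +
      ∑ S ∈ F.powerset, δ ^ S.card * (1 - δ) ^ (F \ S).card *
        obsNorm (edgeProb δ A) (innerEdges U)
          (rootedLaw w (S.toList ++ rs) (pushRoot (transition p A) S.card c)) := by
  have hδ' : 0 ≤ 1 - δ := by linarith
  have hB : 0 ≤ B := (abs_nonneg _).trans (hc [])
  have hq0 : ∀ (e : Sym2 V) X, 0 ≤ edgeProb δ A e X := fun e X => mul_nonneg hδ0 (h.pos _).le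
  have hqK : ∀ (e : Sym2 V) X, edgeProb δ A e X ≤ δ * K := fun e X =>
    mul_le_mul_of_nonneg_left (hK _) hδ0
  have hq1 : ∀ (e : Sym2 V) X, edgeProb δ A e X ≤ 1 := fun e X => (hqK e X).trans hδK
  have hvF : v ∉ F := fun hvF => hvU (hFU hvF)
  have hinj := injective_sym2_mk v
  have hsplit : innerEdges (insert v U) = (innerEdges U ∪ F.image fun u => s(v, u)) ∪
      (U \ F).image fun u => s(v, u) := by
    rw [innerEdges_insert hvU, Finset.union_assoc, ← Finset.image_union,
      Finset.union_sdiff_of_subset hFU]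
  have hdisj : Disjoint (innerEdges U ∪ F.image fun u => s(v, u))
      ((U \ F).image fun u => s(v, u)) := by
    rw [Finset.disjoint_union_left]
    exact ⟨disjoint_innerEdges_image hvU _,
      (Finset.disjoint_image hinj).2 Finset.disjoint_sdiff⟩
  have hmass := sum_abs_rootedLaw_le hw0 hw1 (v :: rs) hc
  rw [List.length_cons] at hmass
  -- The pairs from `v` to the exceptional vertices `U \ F` are discarded first.
  have step1 := obsNorm_union_le hq0 hq1 hqK hdisj (rootedLaw w (v :: rs) c)
  rw [← hsplit, Finset.card_image_of_injective _ hinj] at step1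
  have step1' : ((U \ F).card : ℝ) * (2 * (δ * K) * ∑ X, |rootedLaw w (v :: rs) c X|) ≤
      (U \ F).card * (2 * (δ * K) * (B * 2 ^ (rs.length + 1))) := by
    have : 0 ≤ δ * K := mul_nonneg hδ0 ((h.pos s(0, 0)).le.trans (hK _))
    gcongr
  rw [obsNorm_union_eq_sum (disjoint_innerEdges_image hvU _), Finset.powerset_image,
    Finset.sum_image (Finset.image_injective hinj).injOn] at step1
  set D : Finset V → (V → Fin 2) → ℝ := fun S X =>
    (∏ u ∈ S, δ * A s(X v, X u)) * ∏ _u ∈ F \ S, (1 - δ)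
  set N : Finset V → (V → Fin 2) → ℝ := fun S X =>
    (∏ u ∈ S, δ * A s(X v, X u)) * ∏ u ∈ F \ S, (1 - δ * A s(X v, X u))
  have hlik : ∀ S X, obsLik (edgeProb δ A) (F.image fun u => s(v, u)) (S.image fun u => s(v, u)) X =
      N S X := fun S X => obsLik_image_star v X
  simp_rw [hlik] at step1
  have step2 : ∑ S ∈ F.powerset, obsNorm (edgeProb δ A) (innerEdges U)
        (fun X => rootedLaw w (v :: rs) c X * N S X) ≤
      ∑ S ∈ F.powerset, obsNorm (edgeProb δ A) (innerEdges U)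
        (fun X => rootedLaw w (v :: rs) c X * D S X) +
      ∑ S ∈ F.powerset, ∑ X, |rootedLaw w (v :: rs) c X * N S X -
        rootedLaw w (v :: rs) c X * D S X| := by
    rw [← Finset.sum_add_distrib]
    exact Finset.sum_le_sum fun S _ =>
      obsNorm_le_add_sum_abs_sub (fun e _ => hq0 e) (fun e _ => hq1 e) _ _
  have step3 : ∑ S ∈ F.powerset, ∑ X, |rootedLaw w (v :: rs) c X * N S X -
        rootedLaw w (v :: rs) c X * D S X| ≤
      B * 2 ^ (rs.length + 1) * (η / 2 + ((1 + 2 * K * δ ^ 2) ^ F.card - 1) / (2 * η)) := by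
    set w' : V → Fin 2 → ℝ := fun u => if u ∈ v :: rs then (fun _ => 1 / 2) else w u
    have hw0' : ∀ u x, 0 ≤ w' u x := fun u x => by
      simp only [w']; split_ifs
      · norm_num
      · exact hw0 u x
    have hw1' : ∀ u, ∑ x, w' u x = 1 := fun u => by
      simp only [w']; split_ifs
      · norm_num
      · exact hw1 u
    have hF' : ∀ u ∈ F, w' u = labelProb p := fun u hu => by
      have : u ∉ v :: rs := by
        rw [List.mem_cons, not_or]
        exact ⟨fun e => hvF (e ▸ hu), hFrs u hu⟩
      simp only [w', if_neg this, hF u hu]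
    refine le_trans ?_ (mul_le_mul_of_nonneg_left
      (sum_abs_nonEdge_sub_le h hδ0 hδ1 hK hw0' hw1' hvF hF' hη) (by positivity))
    simp_rw [Finset.mul_sum]
    refine Finset.sum_le_sum fun S _ => Finset.sum_le_sum fun X _ => ?_
    have hS : 0 ≤ ∏ u ∈ S, δ * A s(X v, X u) :=
      Finset.prod_nonneg fun u _ => mul_nonneg hδ0 (h.pos _).le
    rw [← mul_sub, ← mul_sub, abs_mul, abs_mul, abs_of_nonneg hS, ← mul_assoc (B * _)]
    exact mul_le_mul_of_nonneg_right (abs_rootedLaw_le hw0 (v :: rs) hc X)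
      (mul_nonneg hS (abs_nonneg _))
  -- With the absent edges replaced by a constant, `v` enters only through its edges to `S`, and its
  -- label can be summed out.
  have step4 : ∀ S ∈ F.powerset, obsNorm (edgeProb δ A) (innerEdges U)
        (fun X => rootedLaw w (v :: rs) c X * D S X) =
      δ ^ S.card * (1 - δ) ^ (F \ S).card * obsNorm (edgeProb δ A) (innerEdges U)
          (rootedLaw w (S.toList ++ rs) (pushRoot (transition p A) S.card c)) := by
    intro S hS
    have hS := Finset.mem_powerset.1 hS
    have hm := sum_update_rootedLaw (δ := δ) (A := A) hw1 hv (fun e => hvF (hS e))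
      (fun u hu => hFrs u (hS hu)) (fun u hu => hF u (hS hu)) c
    rw [← obsNorm_mul_left (by positivity)]
    refine obsNorm_congr_of_marginal v (fun e he X x => edgeProb_update
      (fun hve => hvU (mem_of_mem_innerEdges he hve)) X x) fun X => ?_
    calc _ = (1 - δ) ^ (F \ S).card * ∑ x, rootedLaw w (v :: rs) c (Function.update X v x) *
          ∏ u ∈ S, δ * A s((Function.update X v x) v, (Function.update X v x) u) := by
          rw [Finset.mul_sum]
          refine Finset.sum_congr rfl fun x _ => ?_
          simp only [D, Finset.prod_const]
          ring
      _ = _ := by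
          rw [hm, Finset.mul_sum]
          exact Finset.sum_congr rfl fun x _ => by ring
  rw [Finset.sum_congr rfl step4] at step2
  linarith

end RootExposure

end SBM

namespace SBM
open scoped ENNReal

/-! ### Asymptotic domination by tree experiments: base cases and error terms. -/

section Asymptotics

variable {p d : ℝ} {A : Sym2 (Fin 2) → ℝ}

open scoped Classical in
/-- Asymptotically in the number of vertices, the observation of the graph on `U` is at most as
informative on the labels of the roots as the independent experiments `l`, even if up to `D` other
vertices are removed or have known labels. -/
def RiskBound (p d : ℝ) (A : Sym2 (Fin 2) → ℝ) (l : List (Measure (Fin 2 → ℝ))) : Prop :=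
  ∀ (c : List (Fin 2) → ℝ) (B : ℝ), (∀ xs, |c xs| ≤ B) → ∀ (D : ℕ) (ε : ℝ), 0 < ε →
    ∀ᶠ n : ℕ in atTop, ∀ (U : Finset (Fin n)) (w : Fin n → Fin 2 → ℝ) (rs : List (Fin n)),
      rs.length = l.length → rs.Nodup → (∀ r ∈ rs, r ∈ U) → (∀ u x, 0 ≤ w u x) →
      (∀ u, ∑ x, w u x = 1) →
      (Finset.univ.filter fun u => u ∉ U ∨ w u ≠ labelProb p).card ≤ D →
      ENNReal.ofReal (obsNorm (edgeProb (d / n) A) (innerEdges U) (rootedLaw w rs c)) ≤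
        risk l c + ENNReal.ofReal ε

lemma Admissible.exists_bound (A : Sym2 (Fin 2) → ℝ) : ∃ K, ∀ e, A e ≤ K := by
  obtain ⟨K, hK⟩ := (Set.finite_range A).bddAbove
  exact ⟨K, fun e => hK ⟨e, rfl⟩⟩

lemma eventually_edgeProb (h : Admissible p d A) :
    ∀ᶠ n : ℕ in atTop, ∀ (e : Sym2 (Fin n)) X, 0 ≤ edgeProb (d / n) A e X ∧
      edgeProb (d / n) A e X ≤ 1 := by
  obtain ⟨K, hK⟩ := Admissible.exists_bound A
  have : Tendsto (fun n : ℕ => d / n * K) atTop (𝓝 0) := by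
    simpa using (tendsto_const_div_atTop_nhds_zero_nat d).mul_const K
  filter_upwards [this.eventually (ge_mem_nhds one_pos)] with n hn e X
  have hd : 0 ≤ d / n := div_nonneg h.d_pos.le n.cast_nonneg
  exact ⟨mul_nonneg hd (h.pos _).le, (mul_le_mul_of_nonneg_left (hK _) hd).trans hn⟩

lemma riskBound_nil (h : Admissible p d A) : RiskBound p d A [] := by
  intro c B hc D ε hε
  filter_upwards [eventually_edgeProb h] with n hn U w rs hrs _ _ hw0 hw1 _
  obtain rfl : rs = [] := List.length_eq_zero_iff.1 hrs
  refine le_add_right ?_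
  rw [risk, ← ofReal_norm, Real.norm_eq_abs]
  refine ENNReal.ofReal_le_ofReal ((obsNorm_le_sum_abs (fun e _ X => (hn e X).1)
    (fun e _ X => (hn e X).2) _).trans (le_of_eq ?_))
  have hp : ∀ X : Fin n → Fin 2, 0 ≤ ∏ u, w u (X u) := fun X =>
    Finset.prod_nonneg fun u _ => hw0 u _
  simp only [rootedLaw, List.map_nil, List.toFinset_nil, Finset.sdiff_empty, abs_mul,
    fun X => abs_of_nonneg (hp X)]
  rw [← Finset.mul_sum, sum_prod_labels]
  simp [hw1]

lemma risk_treeExperiment_zero_cons (κ : Fin 2 → Fin 2 → ℝ) (d : ℝ)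
    {l : List (Measure (Fin 2 → ℝ))} (hl : ∀ ν ∈ l, IsExperiment ν) (c : List (Fin 2) → ℝ) :
    risk (treeExperiment κ d 0 :: l) c =
      risk l (fun xs => c (0 :: xs)) + risk l (fun xs => c (1 :: xs)) := by
  have hmeas : Measurable fun ℓ : Fin 2 → ℝ => risk l (fun xs => ∑ x, ℓ x * c (x :: xs)) := by
    refine (measurable_risk l fun ν h => ?_).comp (measurable_pi_lambda _ fun xs => ?_)
    · have := (hl ν h).finite
      infer_instance
    · fun_prop
  rw [risk, treeExperiment, lintegral_add_measure, lintegral_dirac' _ hmeas,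
    lintegral_dirac' _ hmeas]
  simp

/-- Revealing the root label splits the signed law in two, and the norm is subadditive. In each half
the root has a known label, which is one more exceptional vertex: hence `D + 1`. -/
lemma riskBound_treeExperiment_zero_cons (κ : Fin 2 → Fin 2 → ℝ)
    {l : List (Measure (Fin 2 → ℝ))} (hl : ∀ ν ∈ l, IsExperiment ν) (hlB : RiskBound p d A l) :
    RiskBound p d A (treeExperiment κ d 0 :: l) := by
  classical
  intro c B hc D ε hε
  filter_upwards [hlB (fun xs => c (0 :: xs)) B (fun xs => hc _) (D + 1) (ε / 2) (by positivity),
    hlB (fun xs => c (1 :: xs)) B (fun xs => hc _) (D + 1) (ε / 2) (by positivity)]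
    with n h0 h1 U w rs hrs hnd hU hw0 hw1 hD
  obtain ⟨v, rs, rfl⟩ : ∃ v rs', rs = v :: rs' := List.exists_cons_of_length_eq_add_one hrs
  rw [List.nodup_cons] at hnd
  set w' : Fin 2 → Fin n → Fin 2 → ℝ := fun x => Function.update w v (Pi.single x 1)
  have hw0' : ∀ x u y, 0 ≤ w' x u y := fun x u y => by
    by_cases huv : u = v
    · subst huv
      simp only [w', Function.update_self, Pi.single_apply]
      split_ifs <;> norm_num
    · simpa [w', huv] using hw0 u y
  have hw1' : ∀ x u, ∑ y, w' x u y = 1 := fun x u => by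
    by_cases huv : u = v
    · subst huv
      simp [w', Pi.single_apply]
    · simpa [w', huv] using hw1 u
  have hD' : ∀ x, (Finset.univ.filter fun u => u ∉ U ∨ w' x u ≠ labelProb p).card ≤ D + 1 := by
    intro x
    refine (Finset.card_le_card (t := insert v (Finset.univ.filter fun u => u ∉ U ∨
      w u ≠ labelProb p)) fun u hu => ?_).trans ((Finset.card_insert_le _ _).trans (by lia))
    by_cases huv : u = v
    · simp [huv]
    · simpa [w', huv] using hu
  have hsplit : rootedLaw w (v :: rs) c = fun X =>
      rootedLaw (w' 0) rs (fun xs => c (0 :: xs)) X +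
        rootedLaw (w' 1) rs (fun xs => c (1 :: xs)) X := by
    ext X
    have hset : (Finset.univ \ rs.toFinset).erase v = Finset.univ \ (v :: rs).toFinset := by
      ext u; simp
    have hvm : v ∈ Finset.univ \ rs.toFinset := by simp [hnd.1]
    have hprod : ∀ x, ∏ u ∈ Finset.univ \ rs.toFinset, w' x u (X u) =
        (if X v = x then 1 else 0) * ∏ u ∈ Finset.univ \ (v :: rs).toFinset, w u (X u) := by
      intro x
      rw [← Finset.mul_prod_erase _ _ hvm, hset]
      congr 1
      · simp [w', Pi.single_apply]
      · refine Finset.prod_congr rfl fun u hu => ?_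
        rw [← hset] at hu
        simp [w', Finset.ne_of_mem_erase hu]
    simp only [rootedLaw, hprod, List.map_cons]
    generalize X v = x
    fin_cases x <;> simp
  have hrs' : rs.length = l.length := by simpa using hrs
  have hU' : ∀ r ∈ rs, r ∈ U := fun r hr => hU r (List.mem_cons_of_mem _ hr)
  rw [hsplit, risk_treeExperiment_zero_cons κ d hl]
  calc _ ≤ ENNReal.ofReal (_ + _) := ENNReal.ofReal_le_ofReal (obsNorm_add_le _ _ _ _)
    _ ≤ ENNReal.ofReal _ + ENNReal.ofReal _ := ENNReal.ofReal_add_le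
    _ ≤ _ := add_le_add (h0 U (w' 0) rs hrs' hnd.2 hU' (hw0' 0) (hw1' 0) (hD' 0))
        (h1 U (w' 1) rs hrs' hnd.2 hU' (hw0' 1) (hw1' 1) (hD' 1))
    _ = _ := by
        rw [add_add_add_comm, ← ENNReal.ofReal_add (by positivity) (by positivity), add_halves]

lemma abs_pushRoot_le (h : Admissible p d A) {c : List (Fin 2) → ℝ} {B : ℝ}
    (hc : ∀ xs, |c xs| ≤ B) (k : ℕ) (zs : List (Fin 2)) :
    |pushRoot (transition p A) k c zs| ≤ 2 * B := by
  have hprod : ∀ (x : Fin 2) (ys : List (Fin 2)), 0 ≤ (ys.map (transition p A x)).prod ∧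
      (ys.map (transition p A x)).prod ≤ 1 := by
    intro x ys
    induction ys with
    | nil => simp
    | cons y ys ih =>
      rw [List.map_cons, List.prod_cons]
      exact ⟨mul_nonneg (h.transition_pos x y).le ih.1,
        mul_le_one₀ (h.transition_le_one x y) ih.1 ih.2⟩
  unfold pushRoot
  refine (Finset.abs_sum_le_sum_abs _ _).trans ?_
  calc _ ≤ ∑ _x : Fin 2, B := by
        refine Finset.sum_le_sum fun x _ => ?_
        rw [abs_mul, abs_of_nonneg (hprod _ _).1]
        calc _ ≤ 1 * |c (x :: zs.drop k)| :=
              mul_le_mul_of_nonneg_right (hprod _ _).2 (abs_nonneg _)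
          _ ≤ B := by rw [one_mul]; exact hc _
    _ = 2 * B := by simp

/-- Since `n * (d / n) ^ 2 → 0`, the absent edges lose their information. Only the term with `η / 2`
survives, and `η` can be taken small. -/
lemma tendsto_exposure_error (d K η c₁ c₂ : ℝ) :
    Tendsto (fun n : ℕ => c₁ * (d / n) +
      c₂ * (η / 2 + ((1 + 2 * K * (d / n) ^ 2) ^ n - 1) / (2 * η))) atTop (𝓝 (c₂ * (η / 2))) := by
  have h0 : Tendsto (fun n : ℕ => d / n) atTop (𝓝 0) := tendsto_const_div_atTop_nhds_zero_nat d
  have h1 : Tendsto (fun n : ℕ => (1 + 2 * K * (d / n) ^ 2) ^ n) atTop (𝓝 1) := by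
    have : Tendsto (fun n : ℕ => (n : ℝ) * (2 * K * (d / n) ^ 2)) atTop (𝓝 0) := by
      have h2 : Tendsto (fun n : ℕ => 2 * K * d * (d / n)) atTop (𝓝 0) := by
        simpa using h0.const_mul (2 * K * d)
      refine h2.congr' ?_
      filter_upwards [eventually_ne_atTop 0] with n hn
      field_simp
    simpa using Real.tendsto_one_add_pow_exp_of_tendsto this
  have h2 := ((h0.const_mul c₁).add ((((h1.sub_const 1).div_const (2 * η)).const_add
    (η / 2)).const_mul c₂))
  simpa using h2

/-- Binomial weights, with slightly fewer trials than prescribed, are eventually at most the Poisson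
weights. -/
lemma eventually_binomial_le_poissonWeight (hd : 0 < d) (D k : ℕ) {ε : ℝ} (hε : 0 < ε) :
    ∀ᶠ n : ℕ in atTop, ∀ m ≤ n, n ≤ m + D → k ≤ m →
      m.choose k * ((d / n) ^ k * (1 - d / n) ^ (m - k)) ≤ poissonWeight d k + ε := by
  have h0 : Tendsto (fun n : ℕ => d / n) atTop (𝓝 0) := tendsto_const_div_atTop_nhds_zero_nat d
  have h1 : Tendsto (fun n : ℕ => (n : ℝ) * (d / n)) atTop (𝓝 d) := by
    refine (tendsto_const_nhds (x := d)).congr' ?_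
    filter_upwards [eventually_ne_atTop 0] with n hn
    field_simp
  have h2 := tendsto_choose_mul_pow_of_tendsto_mul_atTop k h1
  have h3 : Tendsto (fun n : ℕ => ((1 - d / n) ^ D)⁻¹) atTop (𝓝 1) := by
    simpa using ((h0.const_sub 1).pow D).inv₀ (by simp)
  have h4 := h2.mul h3
  rw [mul_one] at h4
  filter_upwards [h4.eventually (ge_mem_nhds (show _ < poissonWeight d k + ε from
    lt_add_of_pos_right _ hε)), h0.eventually (gt_mem_nhds one_pos)] with n hn hn1 m hm hmD hk
  refine le_trans ?_ hn
  have hx : 0 < 1 - d / n := by linarith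
  have hx1 : 1 - d / n ≤ 1 := by
    have : 0 ≤ d / n := div_nonneg hd.le n.cast_nonneg
    linarith
  have e1 : (1 - d / n) ^ (m - k) ≤ (1 - d / n) ^ (n - k) * ((1 - d / n) ^ D)⁻¹ := by
    rw [← div_eq_mul_inv, le_div_iff₀ (by positivity), ← pow_add]
    exact pow_le_pow_of_le_one hx.le hx1 (by lia)
  have e2 : (m.choose k : ℝ) ≤ n.choose k := by exact_mod_cast Nat.choose_le_choose k hm
  have e3 : 0 ≤ d / n := div_nonneg hd.le n.cast_nonneg
  calc _ ≤ (n.choose k : ℝ) * ((d / n) ^ k * ((1 - d / n) ^ (n - k) * ((1 - d / n) ^ D)⁻¹)) := by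
        gcongr
    _ = _ := by ring

/-- For `δ = d / n` this domination does not depend on `n`; it controls large degrees. -/
lemma binomial_le_pow_div_factorial {δ : ℝ} (hδ0 : 0 ≤ δ) (hδ1 : δ ≤ 1) {n m : ℕ} (hmn : m ≤ n)
    (k : ℕ) : m.choose k * (δ ^ k * (1 - δ) ^ (m - k)) ≤ (n * δ) ^ k / (k.factorial : ℝ) := by
  have h1 : (m.choose k : ℝ) ≤ (n : ℝ) ^ k / k.factorial :=
    (Nat.choose_le_pow_div k m).trans (by gcongr)
  have h2 : (1 - δ) ^ (m - k) ≤ 1 := pow_le_one₀ (by linarith) (by linarith)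
  have h3 : 0 ≤ (1 - δ) ^ (m - k) := pow_nonneg (by linarith) _
  calc _ ≤ (n : ℝ) ^ k / k.factorial * (δ ^ k * 1) := by gcongr
    _ = _ := by rw [mul_pow]; ring

end Asymptotics

end SBM

namespace SBM
open scoped ENNReal

/-! ### The inductive step: from the children to the root. -/

section Recursion

variable {p d : ℝ} {A : Sym2 (Fin 2) → ℝ}

lemma summable_pow_div_factorial_mul (d B : ℝ) (m : ℕ) :
    Summable fun k : ℕ => d ^ k / (k.factorial : ℝ) * (2 * B * 2 ^ (k + m)) := by
  have h := (Real.summable_pow_div_factorial (2 * d)).mul_right (2 * B * 2 ^ m)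
  refine h.congr fun k => ?_
  rw [mul_pow, pow_add]; ring

/-- Summing over neighbour sets gives a binomial average over the degree `k`. On a finite set of
degrees the hypothesis `hB` and the Poisson limit apply; the other degrees are bounded by the tail
of an exponential series. -/
lemma riskBound_nextLevel_cons (h : Admissible p d A) {ν : Measure (Fin 2 → ℝ)}
    (hν : IsExperiment ν) {l : List (Measure (Fin 2 → ℝ))} (hl : ∀ ν ∈ l, IsExperiment ν)
    (hB : ∀ k, RiskBound p d A (List.replicate k ν ++ l)) :
    RiskBound p d A (nextLevel (transition p A) d ν :: l) := by
  classical
  intro c B hc D ε hε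
  have hB0 : 0 ≤ B := (abs_nonneg _).trans (hc [])
  obtain ⟨K, hK⟩ := Admissible.exists_bound A
  have hK0 : 0 ≤ K := (h.pos s(0, 0)).le.trans (hK _)
  set m := l.length
  set κ := transition p A
  set R : ℕ → ℝ≥0∞ := fun k => risk (List.replicate k ν ++ l) (pushRoot κ k c)
  have hRtop : ∀ k, R k ≠ ∞ := fun k => by
    refine ne_top_of_le_ne_top ?_ (risk_le (B := ENNReal.ofReal (2 * B)) (fun ν' hν' => ?_) _
      fun zs => ?_)
    · exact ENNReal.mul_ne_top (by simp) ENNReal.ofReal_ne_top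
    · rcases List.mem_append.1 hν' with h1 | h1
      · rw [List.eq_of_mem_replicate h1]; exact hν
      · exact hl _ h1
    · rw [← ofReal_norm, Real.norm_eq_abs]
      exact ENNReal.ofReal_le_ofReal (abs_pushRoot_le h hc k zs)
  set T : ℕ → ℝ := fun k => d ^ k / (k.factorial : ℝ) * (2 * B * 2 ^ (k + m))
  -- Finiteness of `s` is what allows the eventual bounds for the different degrees to be used
  -- simultaneously.
  obtain ⟨s, hs⟩ := summable_iff_vanishing_norm.1 (summable_pow_div_factorial_mul d B m) (ε / 8)
    (by positivity)
  set H : ℝ := ∑ k ∈ s, ((R k).toReal + ε / 8)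
  have hH0 : 0 ≤ H := Finset.sum_nonneg fun k _ => by positivity
  set c₂ : ℝ := B * 2 ^ (m + 1)
  have hc₂ : 0 ≤ c₂ := by positivity
  -- Chosen so that the limiting exposure error `c₂ * (η / 2)` is below `ε / 4`; the `+ 1` covers
  -- `c₂ = 0`.
  set η : ℝ := ε / (8 * (c₂ + 1))
  have hη : 0 < η := by positivity
  have hη2 : c₂ * (η / 2) < ε / 4 := by
    have : c₂ * (η / 2) = ε / 16 * (c₂ / (c₂ + 1)) := by simp only [η]; field_simp; ring
    have h1 : c₂ / (c₂ + 1) ≤ 1 := (div_le_one (by positivity)).2 (by linarith)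
    rw [this]
    have := mul_le_mul_of_nonneg_left h1 (show 0 ≤ ε / 16 by positivity)
    linarith
  set c₁ : ℝ := (D + m : ℕ) * (2 * K * c₂)
  have hδlim : Tendsto (fun n : ℕ => d / n) atTop (𝓝 0) := tendsto_const_div_atTop_nhds_zero_nat d
  have hδK : Tendsto (fun n : ℕ => d / n * K) atTop (𝓝 0) := by simpa using hδlim.mul_const K
  -- `D + 1` accounts for the removal of the exposed root; `D + m + 1` bounds the vertices that are
  -- not fresh: `D` exceptional ones, `m` other roots and `v` itself.
  filter_upwards [(Finset.eventually_all s).2 fun k _ => hB k (pushRoot κ k c) (2 * B)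
      (abs_pushRoot_le h hc k) (D + 1) (ε / 8) (by positivity),
    (Finset.eventually_all s).2 fun k _ => eventually_binomial_le_poissonWeight h.d_pos (D + m + 1) k
      (show 0 < ε / (8 * (H + 1)) by positivity),
    (tendsto_exposure_error d K η c₁ c₂).eventually (gt_mem_nhds hη2),
    hδlim.eventually (ge_mem_nhds (show (0 : ℝ) < 1 / 2 by norm_num)),
    hδK.eventually (ge_mem_nhds one_pos), eventually_edgeProb h]
    with n hIH hbin herr hδ2 hδK1 hq U w rs hrs hnd hU hw0 hw1 hD
  have hδ0 : 0 ≤ d / n := div_nonneg h.d_pos.le n.cast_nonneg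
  set δ := d / n
  obtain ⟨v, rs, rfl⟩ : ∃ v rs', rs = v :: rs' := List.exists_cons_of_length_eq_add_one hrs
  rw [List.nodup_cons] at hnd
  have hlen : rs.length = m := by simpa using hrs
  set U' := U.erase v
  have hvU' : v ∉ U' := Finset.notMem_erase v U
  have hUU' : U = insert v U' := (Finset.insert_erase (hU v (by simp))).symm
  set F := U'.filter fun u => u ∉ rs ∧ w u = labelProb p
  have hFU : F ⊆ U' := Finset.filter_subset _ _
  set bad := Finset.univ.filter fun u => u ∉ U ∨ w u ≠ labelProb p
  have hUF : (U' \ F).card ≤ D + m := by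
    calc (U' \ F).card ≤ (bad ∪ rs.toFinset).card := by
          refine Finset.card_le_card fun u hu => ?_
          simp only [F, bad, Finset.mem_sdiff, Finset.mem_filter, not_and, Finset.mem_union,
            Finset.mem_univ, true_and, List.mem_toFinset] at hu ⊢
          by_cases h1 : u ∈ rs
          · exact Or.inr h1
          · exact Or.inl (Or.inr (hu.2 hu.1 h1))
      _ ≤ D + m := (Finset.card_union_le _ _).trans
          (add_le_add hD ((List.toFinset_card_le rs).trans hlen.le))
  have hFn : F.card ≤ n := (Finset.card_le_univ F).trans_eq (Fintype.card_fin n)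
  have hnF : n ≤ F.card + (D + m + 1) := by
    calc n = (Finset.univ : Finset (Fin n)).card := by simp
      _ ≤ (F ∪ (bad ∪ (v :: rs).toFinset)).card := by
          refine Finset.card_le_card fun u _ => ?_
          simp only [F, bad, U', Finset.mem_filter, Finset.mem_erase, Finset.mem_union,
            Finset.mem_univ, true_and, List.mem_toFinset, List.mem_cons]
          tauto
      _ ≤ F.card + (D + (m + 1)) := by
          refine (Finset.card_union_le _ _).trans (add_le_add le_rfl
            ((Finset.card_union_le _ _).trans (add_le_add hD ?_)))
          exact (List.toFinset_card_le _).trans (by simp [hlen])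
  have hmain := obsNorm_root_le h hδ0 hδ2 hK hδK1 hw0 hw1 hnd.1 hvU' hFU
    (fun u hu => (Finset.mem_filter.1 hu).2.1) (fun u hu => (Finset.mem_filter.1 hu).2.2) hc hη
  rw [← hUU', hlen] at hmain
  set g : ℕ → ℝ := fun k => if k ∈ s then (R k).toReal + ε / 8 else 2 * B * 2 ^ (k + m)
  have hg0 : ∀ k, 0 ≤ g k := fun k => by simp only [g]; split_ifs <;> positivity
  have hS : ∀ S ∈ F.powerset, obsNorm (edgeProb δ A) (innerEdges U')
      (rootedLaw w (S.toList ++ rs) (pushRoot κ S.card c)) ≤ g S.card := by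
    intro S hS
    have hS := Finset.mem_powerset.1 hS
    by_cases hk : S.card ∈ s
    · simp only [g, if_pos hk]
      have := hIH S.card hk U' w (S.toList ++ rs) (by simp [hlen, m]) ?_ ?_ hw0 hw1 ?_
      · rw [ENNReal.ofReal_le_iff_le_toReal (ENNReal.add_ne_top.2 ⟨hRtop _, ENNReal.ofReal_ne_top⟩),
          ENNReal.toReal_add (hRtop _) ENNReal.ofReal_ne_top,
          ENNReal.toReal_ofReal (by positivity)] at this
        exact this
      · rw [List.nodup_append']
        refine ⟨Finset.nodup_toList S, hnd.2, fun u hu hu' => ?_⟩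
        exact (Finset.mem_filter.1 (hS (Finset.mem_toList.1 hu))).2.1 hu'
      · intro r hr
        rcases List.mem_append.1 hr with h1 | h1
        · exact hFU (hS (Finset.mem_toList.1 h1))
        · exact Finset.mem_erase.2 ⟨ne_of_mem_of_not_mem h1 hnd.1, hU r (List.mem_cons_of_mem _ h1)⟩
      · refine (Finset.card_le_card (t := insert v bad) fun u hu => ?_).trans
          ((Finset.card_insert_le _ _).trans (by lia))
        simp only [bad, U', Finset.mem_filter, Finset.mem_univ, true_and, Finset.mem_erase,
          Finset.mem_insert] at hu ⊢
        tauto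
    · simp only [g, if_neg hk]
      refine (obsNorm_le_sum_abs (fun e _ X => (hq e X).1) (fun e _ X => (hq e X).2) _).trans
        ((sum_abs_rootedLaw_le hw0 hw1 _ (abs_pushRoot_le h hc _)).trans_eq ?_)
      simp [hlen]
  have hsum : ∑ S ∈ F.powerset, δ ^ S.card * (1 - δ) ^ (F \ S).card *
        obsNorm (edgeProb δ A) (innerEdges U') (rootedLaw w (S.toList ++ rs)
          (pushRoot κ S.card c)) ≤
      ∑ k ∈ Finset.range (F.card + 1), F.card.choose k * (δ ^ k * (1 - δ) ^ (F.card - k)) * g k := by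
    have e := Finset.sum_powerset_apply_card (fun k => δ ^ k * (1 - δ) ^ (F.card - k) * g k) (x := F)
    simp only [nsmul_eq_mul, ← mul_assoc] at e ⊢
    rw [← e]
    refine Finset.sum_le_sum fun S hS' => ?_
    rw [Finset.card_sdiff_of_subset (Finset.mem_powerset.1 hS')]
    have : 0 ≤ 1 - δ := by linarith
    exact mul_le_mul_of_nonneg_left (hS S hS') (by positivity)
  have hweight0 : ∀ k, 0 ≤ F.card.choose k * (δ ^ k * (1 - δ) ^ (F.card - k)) := fun k => by
    have : 0 ≤ 1 - δ := by linarith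
    positivity
  have hin : ∑ k ∈ Finset.range (F.card + 1) ∩ s,
      F.card.choose k * (δ ^ k * (1 - δ) ^ (F.card - k)) * g k ≤
      ∑ k ∈ s, (poissonWeight d k + ε / (8 * (H + 1))) * ((R k).toReal + ε / 8) := by
    calc _ ≤ ∑ k ∈ Finset.range (F.card + 1) ∩ s,
          (poissonWeight d k + ε / (8 * (H + 1))) * ((R k).toReal + ε / 8) := by
          refine Finset.sum_le_sum fun k hk => ?_
          obtain ⟨hk1, hk2⟩ := Finset.mem_inter.1 hk
          simp only [g, if_pos hk2]
          exact mul_le_mul_of_nonneg_right (hbin k hk2 F.card hFn hnF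
            (by have := Finset.mem_range.1 hk1; lia)) (by positivity)
      _ ≤ _ := Finset.sum_le_sum_of_subset_of_nonneg Finset.inter_subset_right fun k _ _ => by
          exact mul_nonneg (add_nonneg (poissonWeight_nonneg h.d_pos.le k) (div_nonneg hε.le
            (by linarith))) (add_nonneg ENNReal.toReal_nonneg (by linarith))
  have hout : ∑ k ∈ Finset.range (F.card + 1) \ s,
      F.card.choose k * (δ ^ k * (1 - δ) ^ (F.card - k)) * g k ≤ ε / 8 := by
    refine le_trans ?_ ((le_abs_self _).trans
      (hs (Finset.range (F.card + 1) \ s) Finset.sdiff_disjoint).le)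
    refine Finset.sum_le_sum fun k hk => ?_
    simp only [g, if_neg (Finset.mem_sdiff.1 hk).2]
    refine mul_le_mul_of_nonneg_right ?_ (by positivity)
    -- For `n = 0` the quotient `d / n` is `0` by convention and `n * δ = d` may fail, but then only
    -- `k = 0` occurs.
    by_cases hn : n = 0
    · have hF0 : F.card = 0 := by lia
      have hk0 : k = 0 := by
        have := Finset.mem_range.1 (Finset.mem_sdiff.1 hk).1
        lia
      simp [hF0, hk0]
    · have := binomial_le_pow_div_factorial hδ0 (by linarith : δ ≤ 1) hFn k
      rwa [show (n : ℝ) * δ = d from mul_div_cancel₀ d (by exact_mod_cast hn)] at this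
  rw [← Finset.sum_inter_add_sum_sdiff _ s] at hsum
  have hsplit : ∑ k ∈ s, (poissonWeight d k + ε / (8 * (H + 1))) * ((R k).toReal + ε / 8) ≤
      ∑ k ∈ s, poissonWeight d k * (R k).toReal + ε / 8 + ε / 8 := by
    have e : ∑ k ∈ s, (poissonWeight d k + ε / (8 * (H + 1))) * ((R k).toReal + ε / 8) =
        ∑ k ∈ s, poissonWeight d k * (R k).toReal + (∑ k ∈ s, poissonWeight d k) * (ε / 8) +
          ε / (8 * (H + 1)) * H := by
      simp only [H]
      rw [Finset.mul_sum, Finset.sum_mul, ← Finset.sum_add_distrib, ← Finset.sum_add_distrib]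
      exact Finset.sum_congr rfl fun k _ => by ring
    have e1 : ∑ k ∈ s, poissonWeight d k ≤ 1 :=
      sum_le_hasSum s (fun k _ => poissonWeight_nonneg h.d_pos.le k)
        (hasSum_poissonWeight h.d_pos.le)
    have e2 : ε / (8 * (H + 1)) * H ≤ ε / 8 := by
      rw [div_mul_eq_mul_div, div_le_div_iff₀ (by linarith) (by norm_num)]
      nlinarith
    have e3 := mul_le_mul_of_nonneg_right e1 (show 0 ≤ ε / 8 by positivity)
    rw [e]
    linarith
  have herr' : (U' \ F).card * (2 * (δ * K) * (B * 2 ^ (m + 1))) +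
      B * 2 ^ (m + 1) * (η / 2 + ((1 + 2 * K * δ ^ 2) ^ F.card - 1) / (2 * η)) ≤ ε / 4 := by
    refine le_trans (add_le_add ?_ (mul_le_mul_of_nonneg_left (add_le_add le_rfl
      (div_le_div_of_nonneg_right (sub_le_sub_right ?_ _) (by positivity))) hc₂)) herr.le
    · have : ((U' \ F).card : ℝ) ≤ (D + m : ℕ) := by exact_mod_cast hUF
      have h2 : 0 ≤ 2 * (δ * K) * c₂ :=
        mul_nonneg (mul_nonneg zero_le_two (mul_nonneg hδ0 hK0)) hc₂
      calc _ ≤ ((D + m : ℕ) : ℝ) * (2 * (δ * K) * (B * 2 ^ (m + 1))) :=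
            mul_le_mul_of_nonneg_right this h2
        _ = _ := by simp only [c₁, c₂]; ring
    · have : 0 ≤ 2 * K * δ ^ 2 := mul_nonneg (mul_nonneg zero_le_two hK0) (sq_nonneg δ)
      exact pow_le_pow_right₀ (by linarith) hFn
  have hfin : obsNorm (edgeProb δ A) (innerEdges U) (rootedLaw w (v :: rs) c) ≤
      ∑ k ∈ s, poissonWeight d k * (R k).toReal + ε := by
    linarith
  calc _ ≤ ENNReal.ofReal (∑ k ∈ s, poissonWeight d k * (R k).toReal + ε) :=
        ENNReal.ofReal_le_ofReal hfin
    _ ≤ ENNReal.ofReal (∑ k ∈ s, poissonWeight d k * (R k).toReal) + ENNReal.ofReal ε :=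
        ENNReal.ofReal_add_le
    _ ≤ _ := by
        gcongr
        rw [risk_nextLevel_cons h.transition_pos h.row d hν hl,
          ENNReal.ofReal_sum_of_nonneg fun k _ => mul_nonneg (poissonWeight_nonneg h.d_pos.le k)
            ENNReal.toReal_nonneg]
        refine le_trans (Finset.sum_le_sum fun k _ => ?_) (ENNReal.sum_le_tsum s)
        rw [ENNReal.ofReal_mul (poissonWeight_nonneg h.d_pos.le k),
          ENNReal.ofReal_toReal (hRtop k)]

/-- The induction on the depth keeps the list arbitrary: a root of depth `r + 1` becomes `k` roots
of depth `r`, prepended one at a time by the inner induction. -/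
lemma riskBound_treeExperiment_cons (h : Admissible p d A) (r : ℕ)
    {l : List (Measure (Fin 2 → ℝ))} (hl : ∀ ν ∈ l, IsExperiment ν) (hlB : RiskBound p d A l) :
    RiskBound p d A (treeExperiment (transition p A) d r :: l) := by
  induction r generalizing l with
  | zero => exact riskBound_treeExperiment_zero_cons _ hl hlB
  | succ r ih =>
    have hν := isExperiment_treeExperiment h.transition_pos h.row h.d_pos.le r
    refine riskBound_nextLevel_cons h hν hl fun k => ?_
    induction k with
    | zero => exact hlB
    | succ k ihk =>
      rw [List.replicate_succ, List.cons_append]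
      refine ih (fun ν' hν' => ?_) ihk
      rcases List.mem_append.1 hν' with h1 | h1
      · rw [List.eq_of_mem_replicate h1]; exact hν
      · exact hl _ h1

end Recursion

end SBM

namespace SBM
open scoped ENNReal

/-! ### From estimators to total variation. -/

section Success

variable {n : ℕ}

open scoped Classical in
/-- The edges of a graph, as a subset of the edges of the complete graph. -/
noncomputable def graphEdges (g : SimpleGraph (Fin n)) : Finset (Sym2 (Fin n)) :=
  (innerEdges Finset.univ).filter fun e => e ∈ g.edgeSet

open scoped Classical in
lemma prod_pairs_eq_obsLik {δ : ℝ} {A : Sym2 (Fin 2) → ℝ} {M : Matrix (Fin 2) (Fin 2) ℝ}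
    (hM : ∀ x y, M x y = δ * A s(x, y)) (g : SimpleGraph (Fin n)) (X : Fin n → Fin 2) :
    (∏ e : Fin n × Fin n with e.1 < e.2,
      if g.Adj e.1 e.2 then M (X e.1) (X e.2) else 1 - M (X e.1) (X e.2)) =
      obsLik (edgeProb δ A) (innerEdges Finset.univ) (graphEdges g) X := by
  have h1 : obsLik (edgeProb δ A) (innerEdges Finset.univ) (graphEdges g) X =
      ∏ e ∈ innerEdges Finset.univ,
        if e ∈ g.edgeSet then edgeProb δ A e X else 1 - edgeProb δ A e X := by
    rw [obsLik, Finset.prod_ite, graphEdges, ← Finset.filter_not]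
  rw [h1]
  refine Finset.prod_bij (fun e _ => s(e.1, e.2)) ?_ ?_ ?_ ?_
  · intro e he
    simp only [innerEdges, Finset.mem_filter, Finset.mem_univ, true_and] at he ⊢
    simpa using he.ne
  · intro e he e' he' heq
    simp only [Finset.mem_filter, Finset.mem_univ, true_and] at he he'
    rcases Sym2.eq_iff.1 heq with ⟨h1, h2⟩ | ⟨h1, h2⟩
    · exact Prod.ext h1 h2
    · exact absurd (h1 ▸ h2 ▸ he) he'.not_gt
  · intro e he
    induction e with
    | h x y =>
      simp only [innerEdges, Finset.mem_filter] at he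
      have hxy : x ≠ y := fun hxy => he.2 (by simpa using hxy)
      rcases lt_or_gt_of_ne hxy with h | h
      · exact ⟨(x, y), by simpa using h, rfl⟩
      · exact ⟨(y, x), by simpa using h, Sym2.eq_swap⟩
  · intro e he
    simp [edgeProb, hM]

open scoped Classical in
lemma sum_graphs_eq_sum_powerset (F : Finset (Sym2 (Fin n)) → ℝ) :
    ∑ g : SimpleGraph (Fin n), F (graphEdges g) =
      ∑ S ∈ (innerEdges (Finset.univ : Finset (Fin n))).powerset, F S := by
  refine Finset.sum_bij' (fun g _ => graphEdges g) (fun S _ => SimpleGraph.fromEdgeSet S)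
    (fun g _ => Finset.mem_powerset.2 (Finset.filter_subset _ _)) (fun _ _ => Finset.mem_univ _)
    ?_ ?_ (fun _ _ => rfl)
  · intro g _
    ext x y
    simp only [graphEdges, innerEdges, SimpleGraph.fromEdgeSet_adj, Finset.coe_filter,
      Set.mem_ofPred_eq, SimpleGraph.mem_edgeSet, Finset.mem_filter, Finset.mk_mem_sym2_iff,
      Finset.mem_univ, true_and, Sym2.mk_isDiag_iff]
    exact ⟨fun h => h.1.2, fun h => ⟨⟨h.ne, h⟩, h.ne⟩⟩
  · intro S hS
    have hS := Finset.mem_powerset.1 hS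
    ext e
    simp only [graphEdges, Finset.mem_filter, SimpleGraph.edgeSet_fromEdgeSet]
    constructor
    · rintro ⟨-, h⟩
      exact h.1
    · intro h
      exact ⟨hS h, h, (Finset.mem_filter.1 (hS h)).2⟩

/-- The coefficients `1` and `-1` on the two labels of a single root. -/
def signCoeff : List (Fin 2) → ℝ
  | [] => 0
  | x :: _ => if x = 0 then 1 else -1

/-- The likelihood of the graph `g` given that the vertex `i` has label `x`. -/
noncomputable def graphLik (p δ : ℝ) (A : Sym2 (Fin 2) → ℝ) (i : Fin n) (x : Fin 2)
    (S : Finset (Sym2 (Fin n))) : ℝ :=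
  ∑ X : Fin n → Fin 2, (if X i = x then ∏ u ∈ Finset.univ \ {i}, labelProb p (X u) else 0) *
    obsLik (edgeProb δ A) (innerEdges Finset.univ) S X

lemma sum_graphLik (p δ : ℝ) (A : Sym2 (Fin 2) → ℝ) (i : Fin n) (x : Fin 2) :
    ∑ S ∈ (innerEdges (Finset.univ : Finset (Fin n))).powerset, graphLik p δ A i x S = 1 := by
  unfold graphLik
  rw [Finset.sum_comm]
  simp_rw [← Finset.mul_sum, sum_obsLik, mul_one]
  have h : ∀ X : Fin n → Fin 2, (if X i = x then ∏ u ∈ Finset.univ \ {i}, labelProb p (X u) else 0) =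
      ∏ u, (if u = i then Pi.single x 1 else labelProb p) (X u) := by
    intro X
    have h1 : ∏ u ∈ Finset.univ \ {i}, (if u = i then Pi.single x 1 else labelProb p) (X u) =
        ∏ u ∈ Finset.univ \ {i}, labelProb p (X u) :=
      Finset.prod_congr rfl fun u hu => by rw [if_neg (by simpa using hu)]
    rw [← Finset.mul_prod_erase _ _ (Finset.mem_univ i), if_pos rfl, Finset.erase_eq, h1]
    simp only [Pi.single_apply]
    split_ifs <;> simp
  simp_rw [h]
  rw [sum_prod_labels]
  refine Finset.prod_eq_one fun u _ => ?_
  split_ifs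
  · simp
  · exact sum_labelProb p

open scoped Classical in
lemma prob_inter_labelEvent {p δ : ℝ} {A : Sym2 (Fin 2) → ℝ} {M : Matrix (Fin 2) (Fin 2) ℝ}
    (hM : ∀ x y, M x y = δ * A s(x, y)) (i : Fin n) (x : Fin 2) (Γ : Set (SimpleGraph (Fin n))) :
    prob p M ({ω | ω.2 ∈ Γ} ∩ labelEvent i x) = labelProb p x *
      ∑ g : SimpleGraph (Fin n), if g ∈ Γ then graphLik p δ A i x (graphEdges g) else 0 := by
  unfold prob
  rw [Fintype.sum_prod_type_right, Finset.mul_sum]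
  refine Finset.sum_congr rfl fun g _ => ?_
  by_cases hg : g ∈ Γ
  · rw [if_pos hg, graphLik, Finset.mul_sum]
    refine Finset.sum_congr rfl fun X _ => ?_
    by_cases hX : X i = x
    · rw [Set.indicator_of_mem (show (X, g) ∈ {ω : Config n | ω.2 ∈ Γ} ∩ labelEvent i x from ⟨hg, hX⟩), if_pos hX, weight,
        prod_pairs_eq_obsLik hM, ← Finset.mul_prod_erase _ _ (Finset.mem_univ i), Finset.erase_eq]
      dsimp only
      rw [hX]
      ring
    · rw [Set.indicator_of_notMem (fun h => hX h.2), if_neg hX]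
      ring
  · rw [if_neg hg, mul_zero]
    exact Finset.sum_eq_zero fun X _ => Set.indicator_of_notMem (fun h => hg h.1) _

open scoped Classical in
lemma condProb_labelEvent {p δ : ℝ} (hp0 : 0 < p) (hp1 : p < 1) {A : Sym2 (Fin 2) → ℝ}
    {M : Matrix (Fin 2) (Fin 2) ℝ} (hM : ∀ x y, M x y = δ * A s(x, y)) (i : Fin n) (x : Fin 2)
    (Γ : Set (SimpleGraph (Fin n))) :
    condProb p M {ω | ω.2 ∈ Γ} (labelEvent i x) =
      ∑ g : SimpleGraph (Fin n), if g ∈ Γ then graphLik p δ A i x (graphEdges g) else 0 := by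
  have h1 : prob p M (labelEvent i x : Set (Config n)) = labelProb p x := by
    have h := prob_inter_labelEvent (p := p) hM i x Set.univ
    simp only [Set.mem_univ, Set.ofPred_true, Set.univ_inter, if_true] at h
    rw [h, sum_graphs_eq_sum_powerset, sum_graphLik, mul_one]
  rw [condProb, h1, prob_inter_labelEvent hM,
    mul_div_cancel_left₀ _ (labelProb_pos hp0 hp1 x).ne']

/-- At each graph an estimator collects one of the two likelihoods, hence at most their maximum,
which is half of the sum plus half of the absolute difference. The likelihoods sum to one, so the
sum part cancels the `- 1`. -/
lemma successProb_le {p δ : ℝ} (hp0 : 0 < p) (hp1 : p < 1) {A : Sym2 (Fin 2) → ℝ}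
    {M : Matrix (Fin 2) (Fin 2) ℝ} (hM : ∀ x y, M x y = δ * A s(x, y)) (hn : 0 < n)
    (T : Estimator n) {b : ℝ}
    (hb : ∀ i : Fin n, obsNorm (edgeProb δ A) (innerEdges Finset.univ)
      (rootedLaw (fun _ => labelProb p) [i] signCoeff) ≤ 2 * b) :
    successProb p M T ≤ b := by
  classical
  have key : ∀ i : Fin n, condProb p M {ω | T ω.2 i = 0} (labelEvent i 0)
      + condProb p M {ω | T ω.2 i = 1} (labelEvent i 1) - 1 ≤ b := by
    intro i
    have e0 := condProb_labelEvent hp0 hp1 hM i 0 {g | T g i = 0}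
    have e1 := condProb_labelEvent hp0 hp1 hM i 1 {g | T g i = 1}
    simp only [Set.mem_ofPred_eq] at e0 e1
    set f : Fin 2 → SimpleGraph (Fin n) → ℝ := fun x g => graphLik p δ A i x (graphEdges g) with hf
    have e0' : condProb p M {ω | T ω.2 i = 0} (labelEvent i 0) =
        ∑ g, if T g i = 0 then f 0 g else 0 := by
      rw [e0]; exact Finset.sum_congr rfl fun g _ => by by_cases h : T g i = 0 <;> simp [h, hf]
    have e1' : condProb p M {ω | T ω.2 i = 1} (labelEvent i 1) =
        ∑ g, if T g i = 1 then f 1 g else 0 := by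
      rw [e1]; exact Finset.sum_congr rfl fun g _ => by by_cases h : T g i = 1 <;> simp [h, hf]
    rw [e0', e1']
    have hs : ∀ x, ∑ g, f x g = 1 := fun x => by
      rw [← sum_graphLik p δ A i x, ← sum_graphs_eq_sum_powerset]
    have hC : ∑ g, |f 0 g - f 1 g| ≤ 2 * b := by
      refine le_trans (le_of_eq ?_) (hb i)
      rw [obsNorm, ← sum_graphs_eq_sum_powerset]
      refine Finset.sum_congr rfl fun g _ => ?_
      simp only [f, graphLik]
      rw [← Finset.sum_sub_distrib]
      congr 1
      refine Finset.sum_congr rfl fun X _ => ?_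
      simp only [rootedLaw, signCoeff, List.map_cons, List.map_nil, List.toFinset_cons,
        List.toFinset_nil, LawfulSingleton.insert_empty_eq]
      generalize X i = x
      fin_cases x <;> simp
    have hpt : ∀ g, (if T g i = 0 then f 0 g else 0) + (if T g i = 1 then f 1 g else 0) ≤
        (f 0 g + f 1 g + |f 0 g - f 1 g|) / 2 := by
      intro g
      have h1 := le_abs_self (f 0 g - f 1 g)
      have h2 := neg_abs_le (f 0 g - f 1 g)
      generalize T g i = t
      fin_cases t <;> simp <;> linarith
    have := Finset.sum_le_sum fun g (_ : g ∈ Finset.univ) => hpt g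
    rw [Finset.sum_add_distrib, ← Finset.sum_div, Finset.sum_add_distrib, Finset.sum_add_distrib,
      hs, hs] at this
    linarith
  have hn' : (0 : ℝ) < n := by exact_mod_cast hn
  calc successProb p M T ≤ (1 / (n : ℝ)) * ∑ _i : Fin n, b := by
        unfold successProb
        gcongr with i
        exact key i
    _ = b := by simp [hn'.ne']

lemma eventually_successProb_le {p d : ℝ} {A : Sym2 (Fin 2) → ℝ} (h : Admissible p d A) (r : ℕ)
    {M : ℕ → Matrix (Fin 2) (Fin 2) ℝ} (hM : ∀ n x y, M n x y = d / n * A s(x, y)) {b : ℝ}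
    (hb : risk [treeExperiment (transition p A) d r] signCoeff < ENNReal.ofReal (2 * b)) :
    ∀ᶠ n : ℕ in atTop, ∀ T : Estimator n, successProb p (M n) T ≤ b := by
  have hbound := riskBound_treeExperiment_cons h r (l := []) (by simp) (riskBound_nil h)
  obtain ⟨ε, hε, hεb⟩ : ∃ ε : ℝ, 0 < ε ∧
      risk [treeExperiment (transition p A) d r] signCoeff + ENNReal.ofReal ε ≤
        ENNReal.ofReal (2 * b) := by
    have hfin := hb.ne_top
    have hb0 : 0 < 2 * b := ENNReal.ofReal_pos.1 (pos_of_gt hb)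
    have h1 := (ENNReal.lt_ofReal_iff_toReal_lt hfin).1 hb
    refine ⟨2 * b - (risk [treeExperiment (transition p A) d r] signCoeff).toReal,
      sub_pos.2 h1, ?_⟩
    refine (add_le_add (ENNReal.ofReal_toReal hfin).ge le_rfl).trans ?_
    rw [← ENNReal.ofReal_add ENNReal.toReal_nonneg (sub_pos.2 h1).le, add_sub_cancel]
  have hb0 : 0 ≤ 2 * b := (ENNReal.ofReal_pos.1 (pos_of_gt hb)).le
  have hc : ∀ xs, |signCoeff xs| ≤ 1 := fun xs => by
    cases xs with
    | nil => simp [signCoeff]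
    | cons x xs => simp only [signCoeff]; split_ifs <;> simp
  filter_upwards [hbound signCoeff 1 hc 0 ε hε, eventually_gt_atTop 0] with n hn hn0 T
  refine successProb_le h.p_pos h.p_lt_one (hM n) hn0 T fun i => ?_
  have := hn Finset.univ (fun _ => labelProb p) [i] (by simp) (by simp) (by simp)
    (fun _ x => (labelProb_pos h.p_pos h.p_lt_one x).le) (fun _ => sum_labelProb p) (by simp)
  exact (ENNReal.ofReal_le_ofReal_iff hb0).1 (this.trans hεb)

end Success

end SBM

namespace SBM
open scoped ENNReal

/-! ### The Gaussian channel: monotonicity of `G` and the limiting success. -/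

section GaussianFunctionals

/-- The law of the log-likelihood ratio in a Gaussian channel of signal-to-noise ratio `μ`. -/
noncomputable def gaussianLogRatio (μ : ℝ) : Measure ℝ := gaussianReal (-(μ / 2)) μ.toNNReal

instance (μ : ℝ) : IsProbabilityMeasure (gaussianLogRatio μ) := by
  unfold gaussianLogRatio; infer_instance

lemma gaussianLogRatio_eq_map {μ : ℝ} (hμ : 0 ≤ μ) :
    gaussianLogRatio μ = (gaussianReal 0 1).map fun z => √μ * z - μ / 2 := by
  have h1 : (fun z : ℝ => √μ * z - μ / 2) = (fun x => x - μ / 2) ∘ fun z => √μ * z := rfl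
  rw [h1, ← Measure.map_map (by fun_prop) (by fun_prop), gaussianReal_map_const_mul,
    gaussianReal_map_sub_const, gaussianLogRatio]
  congr 1
  · ring
  · ext
    simp [Real.sq_sqrt hμ, hμ]

lemma integral_gaussianLogRatio {μ : ℝ} (hμ : 0 ≤ μ) {f : ℝ → ℝ} (hf : Continuous f) :
    ∫ u, f u ∂gaussianLogRatio μ = ∫ z, f (√μ * z - μ / 2) ∂gaussianReal 0 1 := by
  rw [gaussianLogRatio_eq_map hμ, integral_map (by fun_prop) hf.aestronglyMeasurable]

lemma integrable_exp_gaussianLogRatio (μ : ℝ) : Integrable Real.exp (gaussianLogRatio μ) := by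
  have h := integrable_exp_mul_gaussianReal (μ := -(μ / 2)) (v := μ.toNNReal) 1
  simp only [one_mul] at h
  exact h

lemma integral_exp_gaussianLogRatio {μ : ℝ} (hμ : 0 ≤ μ) :
    ∫ u, Real.exp u ∂gaussianLogRatio μ = 1 := by
  have h := mgf_gaussianReal (p := gaussianLogRatio μ) (X := id) (μ := -(μ / 2))
    (v := μ.toNNReal) (by rw [Measure.map_id]; rfl) 1
  simp only [mgf, id, one_mul, mul_one, Real.coe_toNNReal _ hμ] at h
  rw [h]
  simp

lemma gaussianLogRatio_conv {μ s : ℝ} (hμ : 0 ≤ μ) (hs : 0 ≤ s) :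
    (gaussianLogRatio μ).conv (gaussianLogRatio s) = gaussianLogRatio (μ + s) := by
  rw [gaussianLogRatio, gaussianLogRatio, gaussianReal_conv_gaussianReal, gaussianLogRatio,
    Real.toNNReal_add hμ hs]
  congr 1
  ring

/-- The posterior functional whose Gaussian expectation gives `G`. -/
noncomputable def invMix (p u : ℝ) : ℝ := 1 / (p + (1 - p) * Real.exp u)

variable {p : ℝ}

lemma mix_pos (h0 : 0 < p) (h1 : p < 1) (u : ℝ) : 0 < p + (1 - p) * Real.exp u := by
  have := mul_pos (sub_pos.2 h1) (Real.exp_pos u)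
  linarith

lemma continuous_invMix (h0 : 0 < p) (h1 : p < 1) : Continuous (invMix p) :=
  continuous_const.div (by fun_prop) fun u => (mix_pos h0 h1 u).ne'

lemma invMix_nonneg (h0 : 0 < p) (h1 : p < 1) (u : ℝ) : 0 ≤ invMix p u :=
  div_nonneg zero_le_one (mix_pos h0 h1 u).le

lemma invMix_le (h0 : 0 < p) (h1 : p < 1) (u : ℝ) : invMix p u ≤ 1 / p :=
  one_div_le_one_div_of_le h0 (by
    have := mul_pos (sub_pos.2 h1) (Real.exp_pos u)
    linarith)

lemma integrable_invMix (h0 : 0 < p) (h1 : p < 1) (P : Measure ℝ) [IsProbabilityMeasure P] :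
    Integrable (invMix p) P :=
  Integrable.of_bound (continuous_invMix h0 h1).aestronglyMeasurable (1 / p) (ae_of_all _ fun u => by
    rw [Real.norm_eq_abs, abs_of_nonneg (invMix_nonneg h0 h1 u)]
    exact invMix_le h0 h1 u)

lemma G_eq (h0 : 0 < p) (h1 : p < 1) (lam : ℝ) {μ : ℝ} (hμ : 0 ≤ μ) :
    G p lam μ = lam / (1 - p) ^ 2 * (∫ u, invMix p u ∂gaussianLogRatio μ - 1) := by
  have hc := continuous_invMix h0 h1
  have hi : Integrable (fun z => invMix p (√μ * z - μ / 2)) (gaussianReal 0 1) := by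
    have h := integrable_invMix h0 h1 (gaussianLogRatio μ)
    rw [gaussianLogRatio_eq_map hμ, integrable_map_measure hc.aestronglyMeasurable
      (by fun_prop)] at h
    exact h
  rw [G, integral_gaussianLogRatio hμ hc, ← sub_eq_zero]
  have := integral_sub hi (integrable_const (1 : ℝ))
  simp only [invMix] at this ⊢
  rw [this]
  simp

/-- Jensen's inequality for `invMix` against a law with exponential mean one. -/
lemma invMix_le_integral (h0 : 0 < p) (h1 : p < 1) {μ : ℝ} (hμ : 0 ≤ μ) (u : ℝ) :
    invMix p u ≤ ∫ w, invMix p (u + w) ∂gaussianLogRatio μ := by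
  set m := p + (1 - p) * Real.exp u
  have hm : 0 < m := mix_pos h0 h1 u
  -- Minus the slope at `exp w = 1` of the convex map sending `exp w` to `invMix p (u + w)`; the
  -- tangent line integrates to its value there.
  set k := (1 - p) * Real.exp u / m ^ 2
  have hexp := integrable_exp_gaussianLogRatio μ
  have hint1 : Integrable (fun w => k * (Real.exp w - 1)) (gaussianLogRatio μ) :=
    (hexp.sub (integrable_const _)).const_mul _
  have hint : Integrable (fun w => 1 / m - k * (Real.exp w - 1)) (gaussianLogRatio μ) :=
    (integrable_const _).sub hint1
  have hval : ∫ w, (1 / m - k * (Real.exp w - 1)) ∂gaussianLogRatio μ = 1 / m := by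
    rw [integral_sub (integrable_const _) hint1,
      integral_const_mul, integral_sub hexp (integrable_const _), integral_exp_gaussianLogRatio hμ]
    simp
  have hint2 : Integrable (fun w => invMix p (u + w)) (gaussianLogRatio μ) :=
    Integrable.of_bound ((continuous_invMix h0 h1).comp
      (continuous_const_add u)).aestronglyMeasurable (1 / p) (ae_of_all _ fun w => by
        rw [Real.norm_eq_abs, abs_of_nonneg (invMix_nonneg h0 h1 _)]
        exact invMix_le h0 h1 _)
  calc invMix p u = ∫ w, (1 / m - k * (Real.exp w - 1)) ∂gaussianLogRatio μ := hval.symm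
    _ ≤ _ := by
      refine integral_mono hint hint2 fun w => ?_
      have hb := mix_pos h0 h1 (u + w)
      simp only [invMix, k]
      set b := p + (1 - p) * Real.exp (u + w) with hbdef
      have hbm : b - m = (1 - p) * Real.exp u * (Real.exp w - 1) := by
        simp only [hbdef, m, Real.exp_add]; ring
      have e : 1 / b - (1 / m - (1 - p) * Real.exp u / m ^ 2 * (Real.exp w - 1)) =
          (b - m) ^ 2 / (b * m ^ 2) := by
        rw [div_mul_eq_mul_div, ← hbm]
        field_simp
        ring
      have : 0 ≤ (b - m) ^ 2 / (b * m ^ 2) := by positivity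
      linarith

/-- Raising `μ` by `s` amounts to convolving with an independent log-ratio of parameter `s`, and
Jensen applies pointwise. -/
lemma integral_invMix_mono (h0 : 0 < p) (h1 : p < 1) {μ s : ℝ} (hμ : 0 ≤ μ) (hs : 0 ≤ s) :
    ∫ u, invMix p u ∂gaussianLogRatio μ ≤ ∫ u, invMix p u ∂gaussianLogRatio (μ + s) := by
  have hi := integrable_invMix h0 h1 ((gaussianLogRatio μ).conv (gaussianLogRatio s))
  have hi2 : Integrable (fun u => ∫ w, invMix p (u + w) ∂gaussianLogRatio s)
      (gaussianLogRatio μ) := by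
    have h := (integrable_map_measure (f := fun x : ℝ × ℝ => x.1 + x.2)
      (continuous_invMix h0 h1).aestronglyMeasurable (by fun_prop)).1 hi
    exact h.integral_prod_left
  rw [← gaussianLogRatio_conv hμ hs, integral_conv hi]
  exact integral_mono (integrable_invMix h0 h1 _) hi2 fun u => invMix_le_integral h0 h1 hs u

lemma G_mono (h0 : 0 < p) (h1 : p < 1) {lam : ℝ} (hlam : 0 ≤ lam) {μ μ' : ℝ} (hμ : 0 ≤ μ)
    (h : μ ≤ μ') : G p lam μ ≤ G p lam μ' := by
  rw [G_eq h0 h1 lam hμ, G_eq h0 h1 lam (hμ.trans h)]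
  have := integral_invMix_mono h0 h1 hμ (sub_nonneg.2 h)
  rw [add_sub_cancel] at this
  have h2 : 0 ≤ lam / (1 - p) ^ 2 := by positivity
  exact mul_le_mul_of_nonneg_left (by linarith) h2

lemma G_zero (p lam : ℝ) : G p lam 0 = 0 := by simp [G]

lemma G_nonneg (h0 : 0 < p) (h1 : p < 1) {lam : ℝ} (hlam : 0 ≤ lam) {μ : ℝ} (hμ : 0 ≤ μ) :
    0 ≤ G p lam μ := by
  rw [← G_zero p lam]
  exact G_mono h0 h1 hlam le_rfl hμ

lemma G_le (h0 : 0 < p) (h1 : p < 1) {lam : ℝ} (hlam : 0 ≤ lam) {μ : ℝ} (hμ : 0 ≤ μ) :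
    G p lam μ ≤ 1 * lam / (p * (1 - p)) := by
  have hq : 0 < 1 - p := by linarith
  have h : ∫ u, invMix p u ∂gaussianLogRatio μ ≤ 1 / p := by
    have := integral_mono (integrable_invMix h0 h1 (gaussianLogRatio μ)) (integrable_const (1 / p))
      fun u => invMix_le h0 h1 u
    simpa using this
  rw [G_eq h0 h1 lam hμ]
  calc _ ≤ lam / (1 - p) ^ 2 * (1 / p - 1) :=
        mul_le_mul_of_nonneg_left (by linarith) (by positivity)
    _ = _ := by field_simp

lemma muSeq_nonneg (h0 : 0 < p) (h1 : p < 1) {lam : ℝ} (hlam : 0 ≤ lam) (r : ℕ) :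
    0 ≤ muSeq p lam 1 r := by
  have hq : 0 < 1 - p := by linarith
  induction r with
  | zero => unfold muSeq; positivity
  | succ r ih => exact G_nonneg h0 h1 hlam ih

/-- The initial value is an upper bound for `G`, so the first step goes down; monotonicity of `G`
propagates this. -/
lemma antitone_muSeq (h0 : 0 < p) (h1 : p < 1) {lam : ℝ} (hlam : 0 ≤ lam) :
    Antitone (muSeq p lam 1) := by
  refine antitone_nat_of_succ_le fun r => ?_
  induction r with
  | zero => exact G_le h0 h1 hlam (muSeq_nonneg h0 h1 hlam 0)
  | succ r ih => exact G_mono h0 h1 hlam (muSeq_nonneg h0 h1 hlam (r + 1)) ih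

lemma exists_tendsto_muSeq (h0 : 0 < p) (h1 : p < 1) {lam : ℝ} (hlam : 0 ≤ lam) :
    ∃ μ, 0 ≤ μ ∧ Tendsto (muSeq p lam 1) atTop (𝓝 μ) := by
  have hbdd : BddBelow (Set.range (muSeq p lam 1)) :=
    ⟨0, by rintro _ ⟨r, rfl⟩; exact muSeq_nonneg h0 h1 hlam r⟩
  exact ⟨_, le_ciInf (muSeq_nonneg h0 h1 hlam), tendsto_atTop_ciInf (antitone_muSeq h0 h1 hlam) hbdd⟩

/-- The positive part of `1 - exp u`. -/
noncomputable def gain (u : ℝ) : ℝ := max 0 (1 - Real.exp u)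

lemma continuous_gain : Continuous gain := by unfold gain; fun_prop

lemma gain_nonneg (u : ℝ) : 0 ≤ gain u := le_max_left _ _

lemma gain_le_one (u : ℝ) : gain u ≤ 1 :=
  max_le zero_le_one (by have := Real.exp_pos u; linarith)

lemma continuousOn_integral_gain :
    ContinuousOn (fun μ => ∫ u, gain u ∂gaussianLogRatio μ) (Set.Ici 0) := by
  have h : Continuous fun μ : ℝ => ∫ z, gain (√μ * z - μ / 2) ∂gaussianReal 0 1 := by
    refine continuous_of_dominated (bound := fun _ => 1) (fun μ => ?_) (fun μ => ?_)
      (integrable_const _) (ae_of_all _ fun z => ?_)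
    · exact (continuous_gain.comp (by fun_prop)).aestronglyMeasurable
    · refine ae_of_all _ fun z => ?_
      rw [Real.norm_eq_abs, abs_of_nonneg (gain_nonneg _)]
      exact gain_le_one _
    · exact continuous_gain.comp (by fun_prop)
  exact h.continuousOn.congr fun μ hμ => integral_gaussianLogRatio hμ continuous_gain

lemma gaussianPDFReal_neg_mul_exp {μ : ℝ} (hμ : 0 < μ) (u : ℝ) :
    gaussianPDFReal (-(μ / 2)) μ.toNNReal u * Real.exp u =
      gaussianPDFReal (μ / 2) μ.toNNReal u := by
  rw [gaussianPDFReal, gaussianPDFReal, mul_assoc, ← Real.exp_add, Real.coe_toNNReal _ hμ.le]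
  congr 2
  field_simp
  ring

/-- Weighting the density of `N(-μ/2, μ)` by `exp u` gives that of `N(μ/2, μ)`. The integral is
therefore the difference of their masses on the negative half-line, and reflection relates the two.
-/
lemma integral_gain_eq_gaussianSuccess {μ : ℝ} (hμ : 0 ≤ μ) :
    ∫ u, gain u ∂gaussianLogRatio μ = gaussianSuccess μ := by
  rcases hμ.eq_or_lt with rfl | hμ
  · simp [gaussianLogRatio, gaussianSuccess, gain, gaussianReal_zero_var]
  have hv : μ.toNNReal ≠ 0 := by simpa using hμ
  have hd : ∀ u, gain u = (Set.Iio (0 : ℝ)).indicator 1 u -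
      (Set.Iio (0 : ℝ)).indicator Real.exp u := by
    intro u
    by_cases hu : u < 0
    · rw [Set.indicator_of_mem (show u ∈ Set.Iio 0 from hu),
        Set.indicator_of_mem (show u ∈ Set.Iio 0 from hu), gain, max_eq_right]
      · rfl
      · have := Real.exp_lt_one_iff.2 hu; linarith
    · rw [Set.indicator_of_notMem (show u ∉ Set.Iio 0 from hu),
        Set.indicator_of_notMem (show u ∉ Set.Iio 0 from hu), gain, max_eq_left, sub_zero]
      have := Real.one_le_exp (not_lt.1 hu); linarith
  have e1 : ∫ u, (Set.Iio (0 : ℝ)).indicator Real.exp u ∂gaussianLogRatio μ =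
      (gaussianReal (μ / 2) μ.toNNReal).real (Set.Iio 0) := by
    rw [← integral_indicator_one measurableSet_Iio, gaussianLogRatio,
      integral_gaussianReal_eq_integral_smul hv, integral_gaussianReal_eq_integral_smul hv]
    refine integral_congr_ae (ae_of_all _ fun u => ?_)
    simp only [smul_eq_mul]
    by_cases hu : u ∈ Set.Iio (0 : ℝ)
    · rw [Set.indicator_of_mem hu, Set.indicator_of_mem hu, gaussianPDFReal_neg_mul_exp hμ]
      simp
    · rw [Set.indicator_of_notMem hu, Set.indicator_of_notMem hu]
      simp
  have e2 : (gaussianLogRatio μ).real (Set.Iio 0) =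
      (gaussianReal (μ / 2) μ.toNNReal).real (Set.Ioi 0) := by
    rw [gaussianLogRatio, ← gaussianReal_map_neg, map_measureReal_apply (by fun_prop)
      measurableSet_Iio]
    congr 1
    ext u; simp
  have e3 : (gaussianReal (μ / 2) μ.toNNReal).real (Set.Iio 0) =
      1 - (gaussianReal (μ / 2) μ.toNNReal).real (Set.Ioi 0) := by
    have := nullSingletonClass_gaussianReal (μ := μ / 2) hv
    have h := probReal_compl_eq_one_sub (μ := gaussianReal (μ / 2) μ.toNNReal)
      (measurableSet_Ici (a := (0 : ℝ)))
    rw [Set.compl_Ici] at h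
    rw [h, measureReal_def, measureReal_def, Ioi_ae_eq_Ici.measure_eq]
  simp_rw [hd]
  have hi : Integrable ((Set.Iio (0 : ℝ)).indicator (1 : ℝ → ℝ)) (gaussianLogRatio μ) :=
    (integrable_const (1 : ℝ)).indicator measurableSet_Iio
  rw [integral_sub hi
    ((integrable_exp_gaussianLogRatio μ).indicator measurableSet_Iio), e1,
    integral_indicator_one measurableSet_Iio, e2, e3, gaussianSuccess, if_neg hμ.ne']
  ring

end GaussianFunctionals

end SBM

namespace SBM
open scoped ENNReal

/-! ### Weak kernels and the second order expansion of a jump. -/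

section LargeDegree

/-- The binary kernel which keeps the label with probability `η` and otherwise draws
a new label. -/
noncomputable def kernel (p η : ℝ) (x y : Fin 2) : ℝ :=
  (1 - η) * labelProb p y + η * (if x = y then 1 else 0)

lemma sum_kernel (p η : ℝ) (x : Fin 2) : ∑ y, kernel p η x y = 1 := by
  fin_cases x <;> simp [kernel, labelProb] <;> ring

lemma parentLik_kernel_zero (p η : ℝ) (ℓ : Fin 2 → ℝ) :
    parentLik (kernel p η) ℓ 0 = p * ℓ 0 + (1 - p) * ℓ 1 + (1 - p) * η * (ℓ 0 - ℓ 1) := by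
  simp [parentLik, kernel, labelProb]; ring

lemma parentLik_kernel_one (p η : ℝ) (ℓ : Fin 2 → ℝ) :
    parentLik (kernel p η) ℓ 1 = p * ℓ 0 + (1 - p) * ℓ 1 - p * η * (ℓ 0 - ℓ 1) := by
  simp [parentLik, kernel, labelProb]; ring

open Asymptotics Complex in
/-- Second order expansion of the characteristic function of a small log-likelihood ratio. -/
lemma isBigO_logRatio_expansion (p t : ℝ) :
    (fun y : ℝ => (1 + (1 - p) * y : ℂ) *
        (cexp (t * (Real.log ((1 - p * y) / (1 + (1 - p) * y)) : ℝ) * I) - 1) + I * t * y +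
        (I * t + t ^ 2) / 2 * (y : ℂ) ^ 2) =O[𝓝 0] fun y : ℝ => y ^ 3 := by
  have hid : Tendsto (fun y : ℝ => y) (𝓝 0) (𝓝 0) := tendsto_id
  have hlog : ∀ a : ℝ, (fun y : ℝ => Real.log (1 - a * y) + a * y + (a * y) ^ 2 / 2) =O[𝓝 0]
      fun y : ℝ => y ^ 3 := by
    intro a
    have ha : Tendsto (fun y : ℝ => |a * y|) (𝓝 0) (𝓝 0) := by
      simpa using (hid.const_mul a).abs
    refine IsBigO.of_bound (|a| ^ 3 * 2) ?_
    filter_upwards [ha.eventually (ge_mem_nhds (show (0 : ℝ) < 1 / 2 by norm_num))] with y hy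
    have h := Real.abs_log_sub_add_sum_range_le (show |a * y| < 1 by linarith) 2
    simp only [Finset.sum_range_succ, Finset.sum_range_zero] at h
    have e : Real.log (1 - a * y) + a * y + (a * y) ^ 2 / 2 =
        0 + (a * y) ^ (0 + 1) / ((0 : ℕ) + 1) + (a * y) ^ (1 + 1) / ((1 : ℕ) + 1) +
          Real.log (1 - a * y) := by
      push_cast; ring
    rw [Real.norm_eq_abs, e]
    refine h.trans ?_
    rw [div_le_iff₀ (by linarith), Real.norm_eq_abs, abs_pow, abs_mul, mul_pow]
    have h0 : 0 ≤ |a| ^ 3 * |y| ^ 3 := by positivity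
    rw [abs_mul] at hy
    have := mul_nonneg h0 (show 0 ≤ 1 - 2 * (|a| * |y|) by linarith)
    linear_combination this
  set L : ℝ → ℝ := fun y => Real.log ((1 - p * y) / (1 + (1 - p) * y))
  -- The quadratic Taylor coefficient of `L`, that is `((1 - p) ^ 2 - p ^ 2) / 2`.
  set c : ℝ := (1 - 2 * p) / 2
  have hL : (fun y => L y + y - c * y ^ 2) =O[𝓝 0] fun y : ℝ => y ^ 3 := by
    have h := (hlog p).sub (hlog (-(1 - p)))
    refine h.congr' ?_ EventuallyEq.rfl
    have h1 : Tendsto (fun y : ℝ => 1 - p * y) (𝓝 0) (𝓝 1) := by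
      simpa using (hid.const_mul p).const_sub 1
    have h2 : Tendsto (fun y : ℝ => 1 + (1 - p) * y) (𝓝 0) (𝓝 1) := by
      simpa using (hid.const_mul (1 - p)).const_add 1
    filter_upwards [h1.eventually (lt_mem_nhds one_pos), h2.eventually (lt_mem_nhds one_pos)]
      with y hy1 hy2
    simp only [L, c]
    rw [Real.log_div hy1.ne' hy2.ne', show 1 - -(1 - p) * y = 1 + (1 - p) * y by ring]
    ring
  have hpow : ∀ {m k : ℕ}, k ≤ m → (fun y : ℝ => y ^ m) =O[𝓝 0] fun y : ℝ => y ^ k := by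
    intro m k hmk
    refine IsBigO.of_bound 1 ?_
    filter_upwards [Metric.ball_mem_nhds (0 : ℝ) one_pos] with y hy
    rw [mem_ball_zero_iff] at hy
    rw [one_mul, norm_pow, norm_pow]
    exact pow_le_pow_of_le_one (norm_nonneg y) hy.le hmk
  have hL2 : (fun y => L y + y) =O[𝓝 0] fun y : ℝ => y ^ 2 := by
    have h := (hL.trans (hpow (show 2 ≤ 3 by norm_num))).add
      ((isBigO_refl (fun y : ℝ => y ^ 2) (𝓝 0)).const_mul_left c)
    exact h.congr_left fun y => by ring
  have hy1 : (fun y : ℝ => y) =O[𝓝 0] fun y : ℝ => y ^ 1 := by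
    simpa using isBigO_refl (fun y : ℝ => y) (𝓝 0)
  have hL1 : L =O[𝓝 0] fun y : ℝ => y ^ 1 := by
    have h := (hL2.trans (hpow (show 1 ≤ 2 by norm_num))).sub hy1
    exact h.congr_left fun y => by ring
  have hLs : (fun y => L y ^ 2 - y ^ 2) =O[𝓝 0] fun y : ℝ => y ^ 3 := by
    have h := hL2.mul (hL1.sub hy1)
    exact h.congr (fun y => by ring) fun y => by ring
  have hLlim : Tendsto L (𝓝 0) (𝓝 0) := hL1.trans_tendsto (by simpa using hid)
  have hexp : (fun y => cexp (t * (L y : ℝ) * I) - (1 + t * (L y : ℝ) * I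
      + (t * (L y : ℝ) * I) ^ 2 / 2)) =O[𝓝 0] fun y : ℝ => y ^ 3 := by
    have h1 : (fun y => cexp (t * (L y : ℝ) * I) - (1 + t * (L y : ℝ) * I
        + (t * (L y : ℝ) * I) ^ 2 / 2)) =O[𝓝 0] fun y : ℝ => L y ^ 3 := by
      have hs : Tendsto (fun y => |t * L y|) (𝓝 0) (𝓝 0) := by
        simpa using (hLlim.const_mul t).abs
      refine IsBigO.of_bound (|t| ^ 3 * (4 * (6 * 3)⁻¹)) ?_
      filter_upwards [hs.eventually (ge_mem_nhds one_pos)] with y hy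
      have hn : ‖(t * (L y : ℝ) * I : ℂ)‖ = |t * L y| := by
        rw [norm_mul, norm_I, mul_one, ← ofReal_mul, norm_real, Real.norm_eq_abs]
      have h := Complex.exp_bound (x := t * (L y : ℝ) * I) (by rw [hn]; exact hy)
        (show 0 < 3 by norm_num)
      rw [hn] at h
      simp only [Finset.sum_range_succ, Finset.sum_range_zero, Nat.factorial] at h
      rw [abs_mul, mul_pow] at h
      rw [Real.norm_eq_abs, abs_pow]
      convert h using 1
      · congr 1
        push_cast
        ring
      · push_cast
        ring
    have h2 : (fun y => L y ^ 3) =O[𝓝 0] fun y : ℝ => y ^ 3 := by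
      simpa using hL1.pow 3
    exact h1.trans h2
  have hbdd : (fun y : ℝ => (1 + (1 - p) * y : ℂ)) =O[𝓝 0] fun _ : ℝ => (1 : ℝ) := by
    have : Continuous fun y : ℝ => (1 + (1 - p) * y : ℂ) := by fun_prop
    exact (this.tendsto 0).isBigO_one ℝ
  have toC : ∀ {f : ℝ → ℝ}, f =O[𝓝 0] (fun y : ℝ => y ^ 3) →
      (fun y => (f y : ℂ)) =O[𝓝 0] fun y : ℝ => y ^ 3 := fun hf => by
    refine IsBigO.of_norm_left ?_
    simpa using hf.norm_left
  have ht1 : (fun y : ℝ => (1 + (1 - p) * y : ℂ) * (cexp (t * (L y : ℝ) * I) -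
      (1 + t * (L y : ℝ) * I + (t * (L y : ℝ) * I) ^ 2 / 2))) =O[𝓝 0] fun y : ℝ => y ^ 3 := by
    simpa using hbdd.mul hexp
  have ht2 : (fun y : ℝ => (1 + (1 - p) * y : ℂ) * (I * t * ((L y + y - c * y ^ 2 : ℝ) : ℂ) -
      t ^ 2 / 2 * ((L y ^ 2 - y ^ 2 : ℝ) : ℂ))) =O[𝓝 0] fun y : ℝ => y ^ 3 := by
    simpa using hbdd.mul (((toC hL).const_mul_left (I * t)).sub
      ((toC hLs).const_mul_left ((t : ℂ) ^ 2 / 2)))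
  have ht3 : (fun y : ℝ => ((1 - p) * (I * t * c - t ^ 2 / 2) : ℂ) * ((y ^ 3 : ℝ) : ℂ)) =O[𝓝 0]
      fun y : ℝ => y ^ 3 := (toC (isBigO_refl _ _)).const_mul_left _
  refine ((ht1.add ht2).add ht3).congr_left fun y => ?_
  simp only [c]
  push_cast
  linear_combination (-(1 + (1 - p) * y) * (t * L y) ^ 2 / 2 : ℂ) * I_sq

end LargeDegree

end SBM

namespace SBM
open scoped ENNReal

/-! ### Chi-square information and characteristic functions. -/

section Information

/-- The chi-square type information of a binary experiment. -/
noncomputable def infoV (p : ℝ) (ν : Measure (Fin 2 → ℝ)) : ℝ :=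
  ∫ ℓ, (ℓ 0 - ℓ 1) ^ 2 / (p * ℓ 0 + (1 - p) * ℓ 1) ∂ν

variable {p : ℝ} {ν : Measure (Fin 2 → ℝ)}

lemma IsExperiment.integrable (hν : IsExperiment ν) (x : Fin 2) :
    Integrable (fun ℓ => ℓ x) ν := by
  have h0 : 0 ≤ᵐ[ν] fun ℓ => ℓ x := by filter_upwards [hν.nonneg] with ℓ h using h x
  refine (lintegral_ofReal_ne_top_iff_integrable (measurable_pi_apply x).aestronglyMeasurable h0).1 ?_
  rw [hν.mass]
  exact ENNReal.one_ne_top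

lemma IsExperiment.integral (hν : IsExperiment ν) (x : Fin 2) : ∫ ℓ, ℓ x ∂ν = 1 := by
  have h0 : 0 ≤ᵐ[ν] fun ℓ => ℓ x := by filter_upwards [hν.nonneg] with ℓ h using h x
  rw [integral_eq_lintegral_of_nonneg_ae h0 (measurable_pi_apply x).aestronglyMeasurable, hν.mass,
    ENNReal.toReal_one]

lemma mixLik_pos (h0 : 0 < p) (h1 : p < 1) {ℓ : Fin 2 → ℝ} (hn : ∀ x, 0 ≤ ℓ x)
    (hp : 0 < ℓ 0 + ℓ 1) : 0 < p * ℓ 0 + (1 - p) * ℓ 1 := by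
  have hq : 0 < 1 - p := by linarith
  have e0 := mul_nonneg h0.le (hn 0)
  have e1 := mul_nonneg hq.le (hn 1)
  rcases (hn 0).lt_or_eq with h | h
  · have := mul_pos h0 h
    linarith
  · have := mul_pos hq (show 0 < ℓ 1 by linarith)
    linarith

/-- The bound is uniform over experiments, so the expansion variable is small as soon as `η` is. -/
lemma abs_sub_div_mixLik_le (h0 : 0 < p) (h1 : p < 1) {ℓ : Fin 2 → ℝ} (hn : ∀ x, 0 ≤ ℓ x)
    (hp : 0 < ℓ 0 + ℓ 1) :
    |(ℓ 0 - ℓ 1) / (p * ℓ 0 + (1 - p) * ℓ 1)| ≤ 1 / p + 1 / (1 - p) := by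
  have hq : 0 < 1 - p := by linarith
  have hD := mixLik_pos h0 h1 hn hp
  rw [abs_div, abs_of_pos hD, div_le_iff₀ hD]
  have e0 := hn 0
  have e1 := hn 1
  have h2 : |ℓ 0 - ℓ 1| ≤ ℓ 0 + ℓ 1 := abs_le.2 ⟨by linarith, by linarith⟩
  have h3 : (1 / p + 1 / (1 - p)) * (p * ℓ 0 + (1 - p) * ℓ 1) =
      ℓ 0 + ℓ 1 + ((1 - p) / p * ℓ 1 + p / (1 - p) * ℓ 0) := by
    field_simp; ring
  have h4 : 0 ≤ (1 - p) / p * ℓ 1 + p / (1 - p) * ℓ 0 := by positivity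
  linarith

lemma IsExperiment.integrable_infoV (h0 : 0 < p) (h1 : p < 1) (hν : IsExperiment ν) :
    Integrable (fun ℓ => (ℓ 0 - ℓ 1) ^ 2 / (p * ℓ 0 + (1 - p) * ℓ 1)) ν := by
  refine (((hν.integrable 0).add (hν.integrable 1)).const_mul (1 / p + 1 / (1 - p))).mono'
    (Measurable.div (by fun_prop) (by fun_prop)).aestronglyMeasurable ?_
  filter_upwards [hν.nonneg, hν.pos] with ℓ hn hp
  have h2 := abs_sub_div_mixLik_le h0 h1 hn hp
  have e0 := hn 0
  have e1 := hn 1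
  have h3 : |ℓ 0 - ℓ 1| ≤ ℓ 0 + ℓ 1 := abs_le.2 ⟨by linarith, by linarith⟩
  rw [Real.norm_eq_abs, sq, mul_div_right_comm, abs_mul]
  exact mul_le_mul h2 h3 (abs_nonneg _) ((abs_nonneg _).trans h2)

lemma charFun_jump (κ : Fin 2 → Fin 2 → ℝ) (hν : ∀ᵐ ℓ ∂ν, ∀ x, 0 < parentLik κ ℓ x) (t : ℝ) :
    charFun (jump κ ν) t = ∫ ℓ, (parentLik κ ℓ 0 : ℂ) *
      Complex.exp (t * (Real.log (parentLik κ ℓ 1 / parentLik κ ℓ 0) : ℝ) * Complex.I) ∂ν := by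
  rw [charFun_apply_real, jump, integral_map (measurable_logRatio κ).aemeasurable (by fun_prop),
    integral_withDensity_eq_integral_toReal_smul (by fun_prop) (by simp)]
  refine integral_congr_ae ?_
  filter_upwards [hν] with ℓ h
  rw [ENNReal.toReal_ofReal (h 0).le, Complex.real_smul]

open Complex in
/-- Second order expansion of the characteristic function of the jump law of a weak kernel. -/
lemma exists_norm_charFun_jump_le (h0 : 0 < p) (h1 : p < 1) (t : ℝ) :
    ∃ C δ : ℝ, 0 < δ ∧ ∀ η : ℝ, |η| < δ → (∀ x y, 0 < kernel p η x y) →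
      ∀ ν : Measure (Fin 2 → ℝ), IsExperiment ν →
        ‖charFun (jump (kernel p η) ν) t - 1 + (I * t + t ^ 2) / 2 * (η ^ 2 * infoV p ν : ℝ)‖ ≤
          C * |η| * (η ^ 2 * infoV p ν) := by
  obtain ⟨C, hC0, hC⟩ := (isBigO_logRatio_expansion p t).exists_nonneg
  obtain ⟨δ, hδ, hCδ⟩ := Metric.eventually_nhds_iff.1 hC.bound
  have hq : 0 < 1 - p := by linarith
  set Cv := 1 / p + 1 / (1 - p)
  have hCv : 0 < Cv := by positivity
  refine ⟨C * Cv, δ / Cv, by positivity, fun η hη hκ ν hν => ?_⟩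
  set ψ : ℝ → ℂ := fun y => (1 + (1 - p) * y : ℂ) *
        (cexp (t * (Real.log ((1 - p * y) / (1 + (1 - p) * y)) : ℝ) * I) - 1) + I * t * y +
        (I * t + t ^ 2) / 2 * (y : ℂ) ^ 2
  set D : (Fin 2 → ℝ) → ℝ := fun ℓ => p * ℓ 0 + (1 - p) * ℓ 1
  set W : (Fin 2 → ℝ) → ℝ := fun ℓ => (ℓ 0 - ℓ 1) ^ 2 / D ℓ
  have hGpos := hν.parentLik_pos hκ
  set E : (Fin 2 → ℝ) → ℂ := fun ℓ => (parentLik (kernel p η) ℓ 0 : ℂ) *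
    cexp (t * (Real.log (parentLik (kernel p η) ℓ 1 / parentLik (kernel p η) ℓ 0) : ℝ) * I)
  have hW : Integrable W ν := hν.integrable_infoV h0 h1
  have hG : Integrable (fun ℓ => parentLik (kernel p η) ℓ 0) ν := by
    unfold parentLik
    exact integrable_finsetSum _ fun x _ => (hν.integrable x).const_mul _
  have hGint : ∫ ℓ, parentLik (kernel p η) ℓ 0 ∂ν = 1 := by
    unfold parentLik
    rw [integral_finsetSum _ fun x _ => (hν.integrable x).const_mul _]
    simp_rw [integral_const_mul, hν.integral, mul_one]
    exact sum_kernel p η 0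
  have hE : Integrable E ν := by
    refine hG.norm.mono' (by fun_prop) (ae_of_all _ fun ℓ => ?_)
    rw [norm_mul, ← ofReal_mul, norm_exp_ofReal_mul_I, mul_one, norm_real]
  have hdiff : Integrable (fun ℓ : Fin 2 → ℝ => ℓ 0 - ℓ 1) ν :=
    (hν.integrable 0).sub (hν.integrable 1)
  have hdiff0 : ∫ ℓ, (ℓ 0 - ℓ 1) ∂ν = 0 := by
    rw [integral_sub (hν.integrable 0) (hν.integrable 1), hν.integral, hν.integral, sub_self]
  -- With `y = η * (ℓ 0 - ℓ 1) / D ℓ`, both parent likelihoods are `D ℓ` times affine functions of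
  -- `y`. The linear term integrates to zero and the quadratic one to the information.
  have hpt : ∀ᵐ ℓ ∂ν, (D ℓ : ℂ) * ψ (η * ((ℓ 0 - ℓ 1) / D ℓ)) =
      E ℓ - (parentLik (kernel p η) ℓ 0 : ℝ) + I * t * η * ((ℓ 0 - ℓ 1 : ℝ) : ℂ) +
        (I * t + t ^ 2) / 2 * η ^ 2 * (W ℓ : ℝ) := by
    filter_upwards [hν.nonneg, hν.pos, hGpos] with ℓ hn hp hg
    have hD : D ℓ ≠ 0 := (mixLik_pos h0 h1 hn hp).ne'
    have hDC : (D ℓ : ℂ) ≠ 0 := by exact_mod_cast hD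
    have e0 : parentLik (kernel p η) ℓ 0 = D ℓ * (1 + (1 - p) * (η * ((ℓ 0 - ℓ 1) / D ℓ))) := by
      rw [parentLik_kernel_zero, show p * ℓ 0 + (1 - p) * ℓ 1 = D ℓ from rfl]; field_simp
    have e1 : parentLik (kernel p η) ℓ 1 = D ℓ * (1 - p * (η * ((ℓ 0 - ℓ 1) / D ℓ))) := by
      rw [parentLik_kernel_one, show p * ℓ 0 + (1 - p) * ℓ 1 = D ℓ from rfl]; field_simp
    simp only [E, ψ, W]
    rw [e0, e1, mul_div_mul_left _ _ hD]
    generalize cexp _ = z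
    push_cast
    field_simp
  have i1 : Integrable (fun ℓ => E ℓ - ((parentLik (kernel p η) ℓ 0 : ℝ) : ℂ)) ν :=
    hE.sub hG.ofReal
  have i2 : Integrable (fun ℓ : Fin 2 → ℝ => I * t * η * ((ℓ 0 - ℓ 1 : ℝ) : ℂ)) ν :=
    hdiff.ofReal.const_mul _
  have i3 : Integrable (fun ℓ => (I * t + t ^ 2) / 2 * η ^ 2 * ((W ℓ : ℝ) : ℂ)) ν :=
    hW.ofReal.const_mul _
  have i0 : Integrable (fun ℓ => ((parentLik (kernel p η) ℓ 0 : ℝ) : ℂ)) ν := hG.ofReal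
  have i12 : Integrable (fun ℓ => E ℓ - ((parentLik (kernel p η) ℓ 0 : ℝ) : ℂ) +
    I * t * η * ((ℓ 0 - ℓ 1 : ℝ) : ℂ)) ν := i1.add i2
  have hint : ∫ ℓ, (D ℓ : ℂ) * ψ (η * ((ℓ 0 - ℓ 1) / D ℓ)) ∂ν =
      charFun (jump (kernel p η) ν) t - 1 + (I * t + t ^ 2) / 2 * (η ^ 2 * infoV p ν : ℝ) := by
    rw [integral_congr_ae hpt, integral_add i12 i3, integral_add i1 i2,
      integral_sub hE i0, integral_const_mul, integral_const_mul, integral_complex_ofReal,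
      integral_complex_ofReal, integral_complex_ofReal, hGint, hdiff0, charFun_jump _ hGpos]
    simp only [infoV, W, D]
    push_cast
    ring
  rw [← hint]
  calc ‖∫ ℓ, (D ℓ : ℂ) * ψ (η * ((ℓ 0 - ℓ 1) / D ℓ)) ∂ν‖
      ≤ ∫ ℓ, C * Cv * |η| * η ^ 2 * W ℓ ∂ν := by
        refine norm_integral_le_of_norm_le (hW.const_mul _) ?_
        filter_upwards [hν.nonneg, hν.pos] with ℓ hn hp
        have hD : 0 < D ℓ := mixLik_pos h0 h1 hn hp
        have hv := abs_sub_div_mixLik_le h0 h1 hn hp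
        set v := (ℓ 0 - ℓ 1) / D ℓ
        have hWv : W ℓ = D ℓ * v ^ 2 := by simp only [W, v]; field_simp
        have hy : |η * v| < δ := by
          rw [abs_mul]
          calc |η| * |v| ≤ |η| * Cv := mul_le_mul_of_nonneg_left hv (abs_nonneg _)
            _ < δ := (lt_div_iff₀ hCv).1 hη
        have h3 := hCδ (y := η * v) (by simpa using hy)
        rw [norm_mul, norm_real, Real.norm_of_nonneg hD.le]
        calc D ℓ * ‖ψ (η * v)‖ ≤ D ℓ * (C * ‖(η * v) ^ 3‖) :=
              mul_le_mul_of_nonneg_left h3 hD.le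
          _ = D ℓ * C * |η| * η ^ 2 * v ^ 2 * |v| := by
              rw [norm_pow, Real.norm_eq_abs, abs_mul, pow_succ, mul_pow, sq_abs, sq_abs]; ring
          _ ≤ D ℓ * C * |η| * η ^ 2 * v ^ 2 * Cv :=
              mul_le_mul_of_nonneg_left hv (by positivity)
          _ = _ := by rw [hWv]; ring
    _ = C * Cv * |η| * (η ^ 2 * infoV p ν) := by
        rw [integral_const_mul]; simp only [infoV, W, D]; ring

lemma charFun_convPow (J : Measure ℝ) [IsProbabilityMeasure J] (k : ℕ) (t : ℝ) :
    charFun (convPow J k) t = charFun J t ^ k := by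
  induction k with
  | zero => simp [convPow]
  | succ k ih => rw [convPow, charFun_conv, ih, pow_succ']

lemma charFun_compoundPoisson {d : ℝ} (hd : 0 ≤ d) (J : Measure ℝ) [IsProbabilityMeasure J]
    (t : ℝ) : charFun (compoundPoisson d J) t = Complex.exp (d * (charFun J t - 1)) := by
  have := isProbabilityMeasure_compoundPoisson hd J
  have hint : Integrable (fun x : ℝ => Complex.exp (t * x * Complex.I)) (compoundPoisson d J) := by
    refine Integrable.of_bound (by fun_prop) 1 (ae_of_all _ fun x => ?_)
    rw [← Complex.ofReal_mul, Complex.norm_exp_ofReal_mul_I]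
  have h1 := hasSum_integral_measure hint
  simp_rw [integral_smul_measure, ENNReal.toReal_ofReal (poissonWeight_nonneg hd _),
    ← charFun_apply_real, charFun_convPow] at h1
  change HasSum _ (charFun (compoundPoisson d J) t) at h1
  have h2 := (NormedSpace.expSeries_div_hasSum_exp (d * charFun J t : ℂ)).mul_left
    (Complex.exp (-d))
  rw [← Complex.exp_eq_exp_ℂ, ← Complex.exp_add] at h2
  have e : (fun k => poissonWeight d k • charFun J t ^ k) =
      fun k => Complex.exp (-d) * ((d * charFun J t) ^ k / (k.factorial : ℂ)) := by
    funext k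
    rw [Complex.real_smul, poissonWeight]
    push_cast
    rw [mul_pow]
    ring
  rw [e] at h1
  rw [h1.unique h2]
  congr 1
  ring

end Information

end SBM

namespace SBM
open scoped ENNReal

/-! ### Gaussian limit of the tree recursion for large degree. -/

section Limit

variable {p : ℝ}

lemma tendsto_sqrt_div_atTop {ι : Type*} {l : Filter ι} (lam : ℝ) {d : ι → ℝ}
    (hd : Tendsto d l atTop) : Tendsto (fun i => √(lam / d i)) l (𝓝 0) := by
  have h := (Real.continuous_sqrt.tendsto 0).comp (hd.const_div_atTop lam)
  rwa [Real.sqrt_zero] at h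

/-- Since `d * η ^ 2 = lam`, the exponent `d * (charFun - 1)` tends to `-(I * t + t ^ 2) * μ / 2`,
the exponent of `N(-μ/2, μ)`; the cubic error gains a factor `|η| → 0`. -/
lemma tendsto_charFun_compoundPoisson (h0 : 0 < p) (h1 : p < 1) {lam : ℝ} {d η : ℕ → ℝ}
    (hd : Tendsto d atTop atTop) (hη : ∀ n, d n * η n ^ 2 = lam)
    (hκ : ∀ n x y, 0 < kernel p (η n) x y) (hd0 : ∀ n, 0 ≤ d n)
    {ν : ℕ → Measure (Fin 2 → ℝ)} (hν : ∀ n, IsExperiment (ν n)) {μ : ℝ} (hμ : 0 ≤ μ)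
    (hlim : Tendsto (fun n => lam * infoV p (ν n)) atTop (𝓝 μ)) (t : ℝ) :
    Tendsto (fun n => charFun (compoundPoisson (d n) (jump (kernel p (η n)) (ν n))) t) atTop
      (𝓝 (charFun (gaussianLogRatio μ) t)) := by
  obtain ⟨C, δ, hδ, hC⟩ := exists_norm_charFun_jump_le h0 h1 t
  have hη0 : Tendsto (fun n => |η n|) atTop (𝓝 0) := by
    have h2 := tendsto_sqrt_div_atTop lam hd
    refine h2.congr' ?_
    filter_upwards [hd.eventually_gt_atTop 0] with n hn
    rw [← hη n, mul_div_cancel_left₀ _ hn.ne', Real.sqrt_sq_eq_abs]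
  have hψ : ∀ n, charFun (compoundPoisson (d n) (jump (kernel p (η n)) (ν n))) t =
      Complex.exp (d n * (charFun (jump (kernel p (η n)) (ν n)) t - 1)) := fun n => by
    have := isProbabilityMeasure_jump (hκ n) (sum_kernel p (η n)) (hν n)
    exact charFun_compoundPoisson (hd0 n) _ t
  have hsmall : Tendsto (fun n => (d n : ℂ) * (charFun (jump (kernel p (η n)) (ν n)) t - 1) +
      (Complex.I * t + t ^ 2) / 2 * ((lam * infoV p (ν n) : ℝ) : ℂ)) atTop (𝓝 0) := by
    have hb : Tendsto (fun n => C * |η n| * (lam * infoV p (ν n))) atTop (𝓝 0) := by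
      simpa using (hη0.const_mul C).mul hlim
    refine squeeze_zero_norm' ?_ hb
    filter_upwards [hη0.eventually (gt_mem_nhds hδ)] with n hn
    have h := mul_le_mul_of_nonneg_left (hC (η n) hn (hκ n) (ν n) (hν n)) (hd0 n)
    have e : (d n : ℂ) * (charFun (jump (kernel p (η n)) (ν n)) t - 1) +
        (Complex.I * t + t ^ 2) / 2 * ((lam * infoV p (ν n) : ℝ) : ℂ) =
        (d n : ℂ) * (charFun (jump (kernel p (η n)) (ν n)) t - 1 +
          (Complex.I * t + t ^ 2) / 2 * (η n ^ 2 * infoV p (ν n) : ℝ)) := by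
      rw [← hη n]; push_cast; ring
    rw [e, norm_mul, Complex.norm_real, Real.norm_of_nonneg (hd0 n)]
    refine h.trans_eq ?_
    rw [← hη n]; ring
  have hc : Tendsto (fun n => (Complex.I * t + t ^ 2) / 2 * ((lam * infoV p (ν n) : ℝ) : ℂ)) atTop
      (𝓝 ((Complex.I * t + t ^ 2) / 2 * (μ : ℂ))) :=
    ((Complex.continuous_ofReal.tendsto μ).comp hlim).const_mul _
  have hexp := (Complex.continuous_exp.tendsto _).comp (hsmall.sub hc)
  have e2 : charFun (gaussianLogRatio μ) t =
      Complex.exp (0 - (Complex.I * t + t ^ 2) / 2 * (μ : ℂ)) := by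
    rw [gaussianLogRatio, charFun_gaussianReal]
    congr 1
    have : ((μ.toNNReal : ℝ) : ℂ) = μ := by rw [Real.coe_toNNReal _ hμ]
    rw [this]
    push_cast
    ring
  rw [e2]
  refine hexp.congr fun n => ?_
  rw [hψ, Function.comp_apply]
  congr 1
  ring

lemma tendsto_integral_compoundPoisson (h0 : 0 < p) (h1 : p < 1) {lam : ℝ} {d η : ℕ → ℝ}
    (hd : Tendsto d atTop atTop) (hη : ∀ n, d n * η n ^ 2 = lam)
    (hκ : ∀ n x y, 0 < kernel p (η n) x y) (hd0 : ∀ n, 0 ≤ d n)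
    {ν : ℕ → Measure (Fin 2 → ℝ)} (hν : ∀ n, IsExperiment (ν n)) {μ : ℝ} (hμ : 0 ≤ μ)
    (hlim : Tendsto (fun n => lam * infoV p (ν n)) atTop (𝓝 μ))
    {f : ℝ → ℝ} (hf : Continuous f) {B : ℝ} (hB : ∀ u, |f u| ≤ B) :
    Tendsto (fun n => ∫ u, f u ∂(compoundPoisson (d n) (jump (kernel p (η n)) (ν n)))) atTop
      (𝓝 (∫ u, f u ∂gaussianLogRatio μ)) := by
  have hP : ∀ n, IsProbabilityMeasure (compoundPoisson (d n) (jump (kernel p (η n)) (ν n))) :=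
    fun n => by
      have := isProbabilityMeasure_jump (hκ n) (sum_kernel p (η n)) (hν n)
      exact isProbabilityMeasure_compoundPoisson (hd0 n) _
  have h := ProbabilityMeasure.tendsto_of_tendsto_charFun
    (μ := fun n => ⟨compoundPoisson (d n) (jump (kernel p (η n)) (ν n)), hP n⟩)
    (μ₀ := ⟨gaussianLogRatio μ, inferInstance⟩)
    (tendsto_charFun_compoundPoisson h0 h1 hd hη hκ hd0 hν hμ hlim)
  exact ProbabilityMeasure.tendsto_iff_forall_integral_tendsto.1 h
    (BoundedContinuousFunction.ofNormedAddCommGroup f hf B hB)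

/-- Integrability and mean of the exponential from the corresponding lower integral. -/
lemma integrable_exp_and_integral {P : Measure ℝ}
    (hP : ∫⁻ u, ENNReal.ofReal (Real.exp u) ∂P = 1) :
    Integrable Real.exp P ∧ ∫ u, Real.exp u ∂P = 1 := by
  have hn : 0 ≤ᵐ[P] Real.exp := ae_of_all _ fun u => (Real.exp_pos u).le
  have hm : AEStronglyMeasurable Real.exp P := Real.continuous_exp.aestronglyMeasurable
  refine ⟨(lintegral_ofReal_ne_top_iff_integrable hm hn).1 (by rw [hP]; exact ENNReal.one_ne_top), ?_⟩
  rw [integral_eq_lintegral_of_nonneg_ae hn hm, hP, ENNReal.toReal_one]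

/-- With `m = p + (1 - p) * exp u`, the integrand is `(1 / m + m - 2) / (1 - p) ^ 2`, and `m` has
mean one. Multiplication by `lam` gives the form of `G`. -/
lemma infoV_map_likPair (h0 : 0 < p) (h1 : p < 1) {P : Measure ℝ} [IsProbabilityMeasure P]
    (hP : ∫⁻ u, ENNReal.ofReal (Real.exp u) ∂P = 1) :
    infoV p (P.map likPair) = ((1 - p) ^ 2)⁻¹ * (∫ u, invMix p u ∂P - 1) := by
  obtain ⟨hi, he⟩ := integrable_exp_and_integral hP
  have hq : 1 - p ≠ 0 := (sub_pos.2 h1).ne'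
  have hm : Measurable fun ℓ : Fin 2 → ℝ => (ℓ 0 - ℓ 1) ^ 2 / (p * ℓ 0 + (1 - p) * ℓ 1) :=
    Measurable.div (by fun_prop) (by fun_prop)
  have hI := integrable_invMix h0 h1 P
  have hI2 : Integrable (fun u => (1 - p) * Real.exp u + (p - 2)) P :=
    (hi.const_mul _).add (integrable_const _)
  have hpt : ∀ u, (likPair u 0 - likPair u 1) ^ 2 / (p * likPair u 0 + (1 - p) * likPair u 1) =
      ((1 - p) ^ 2)⁻¹ * (invMix p u + ((1 - p) * Real.exp u + (p - 2))) := fun u => by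
    have hD := (mix_pos h0 h1 u).ne'
    simp only [likPair, invMix, if_true, one_ne_zero, if_false, mul_one]
    rw [div_eq_iff hD, inv_mul_eq_div, div_mul_eq_mul_div, eq_div_iff (pow_ne_zero 2 hq), add_mul,
      one_div_mul_cancel hD]
    ring
  rw [infoV, integral_map measurable_likPair.aemeasurable hm.aestronglyMeasurable]
  simp_rw [hpt]
  rw [integral_const_mul, integral_add hI hI2, integral_add (hi.const_mul _) (integrable_const _),
    integral_const_mul, he, integral_const]
  simp
  left; ring

lemma infoV_treeExperiment_zero (h0 : 0 < p) (h1 : p < 1) (κ : Fin 2 → Fin 2 → ℝ) (d : ℝ) :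
    infoV p (treeExperiment κ d 0) = 1 / (p * (1 - p)) := by
  have hq : 1 - p ≠ 0 := (sub_pos.2 h1).ne'
  have hm : Measurable fun ℓ : Fin 2 → ℝ => (ℓ 0 - ℓ 1) ^ 2 / (p * ℓ 0 + (1 - p) * ℓ 1) :=
    Measurable.div (by fun_prop) (by fun_prop)
  have hi : ∀ a : Fin 2 → ℝ, Integrable
      (fun ℓ : Fin 2 → ℝ => (ℓ 0 - ℓ 1) ^ 2 / (p * ℓ 0 + (1 - p) * ℓ 1)) (Measure.dirac a) :=
    fun a => integrable_dirac' hm.stronglyMeasurable (by simp)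
  rw [infoV, treeExperiment, integral_add_measure (hi _) (hi _),
    integral_dirac' _ _ hm.stronglyMeasurable, integral_dirac' _ _ hm.stronglyMeasurable]
  simp
  field_simp
  ring

/-- The information of the broadcast experiment converges to the Gaussian recursion. -/
lemma tendsto_infoV_treeExperiment (h0 : 0 < p) (h1 : p < 1) {lam : ℝ} (hlam : 0 ≤ lam)
    {d η : ℕ → ℝ} (hd : Tendsto d atTop atTop) (hη : ∀ n, d n * η n ^ 2 = lam)
    (hκ : ∀ n x y, 0 < kernel p (η n) x y) (hd0 : ∀ n, 0 ≤ d n) (r : ℕ) :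
    Tendsto (fun n => lam * infoV p (treeExperiment (kernel p (η n)) (d n) r)) atTop
      (𝓝 (muSeq p lam 1 r)) := by
  induction r with
  | zero =>
    simp_rw [infoV_treeExperiment_zero h0 h1]
    rw [muSeq, one_mul, mul_one_div]
    exact tendsto_const_nhds
  | succ r ih =>
    have hν := fun n => isExperiment_treeExperiment (hκ n) (sum_kernel p (η n)) (hd0 n) r
    have hlim := tendsto_integral_compoundPoisson h0 h1 hd hη hκ hd0 hν
      (muSeq_nonneg h0 h1 hlam r) ih (continuous_invMix h0 h1) (B := 1 / p) fun u => by
        rw [abs_of_nonneg (invMix_nonneg h0 h1 u)]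
        exact invMix_le h0 h1 u
    rw [muSeq, G_eq h0 h1 lam (muSeq_nonneg h0 h1 hlam r)]
    refine ((hlim.sub_const 1).const_mul (lam / (1 - p) ^ 2)).congr fun n => ?_
    have := isProbabilityMeasure_jump (hκ n) (sum_kernel p (η n)) (hν n)
    have := isProbabilityMeasure_compoundPoisson (hd0 n)
      (jump (kernel p (η n)) (treeExperiment (kernel p (η n)) (d n) r))
    rw [treeExperiment, nextLevel, infoV_map_likPair h0 h1 (lintegral_exp_compoundPoisson (hd0 n) _
      (lintegral_exp_jump (hκ n) (sum_kernel p (η n)) (hν n)))]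
    ring

/-- The absolute value `|1 - exp u|` is twice the gain plus a term of mean zero. In contrast to it,
the gain is bounded, so weak convergence applies. -/
lemma risk_map_likPair {P : Measure ℝ} [IsProbabilityMeasure P]
    (hP : ∫⁻ u, ENNReal.ofReal (Real.exp u) ∂P = 1) :
    risk [P.map likPair] signCoeff = ENNReal.ofReal (2 * ∫ u, gain u ∂P) := by
  obtain ⟨hi, he⟩ := integrable_exp_and_integral hP
  have hg : Integrable gain P := Integrable.of_bound continuous_gain.aestronglyMeasurable 1
    (ae_of_all _ fun u => by
      rw [Real.norm_eq_abs, abs_of_nonneg (gain_nonneg u)]; exact gain_le_one u)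
  have hr : risk [P.map likPair] signCoeff = ∫⁻ u, ENNReal.ofReal |1 - Real.exp u| ∂P := by
    simp only [risk, signCoeff, Fin.sum_univ_two]
    rw [lintegral_map (by fun_prop) measurable_likPair]
    refine lintegral_congr fun u => ?_
    rw [← ofReal_norm, Real.norm_eq_abs]
    simp [likPair, sub_eq_add_neg]
  have hpt : ∀ u, |1 - Real.exp u| = 2 * gain u + (Real.exp u - 1) := fun u => by
    rcases le_total 0 (1 - Real.exp u) with h | h
    · rw [abs_of_nonneg h, gain, max_eq_right h]; ring
    · rw [abs_of_nonpos h, gain, max_eq_left h]; ring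
  have hi1 : Integrable (fun u => Real.exp u - 1) P := hi.sub (integrable_const _)
  have hi2 : Integrable (fun u => |1 - Real.exp u|) P := ((integrable_const 1).sub hi).abs
  rw [hr, ← ofReal_integral_eq_lintegral_ofReal hi2
    (ae_of_all _ fun u => abs_nonneg _)]
  simp_rw [hpt]
  rw [integral_add (hg.const_mul 2) hi1, integral_const_mul,
    integral_sub hi (integrable_const _), he]
  simp

/-- The index shift: `lam` times the information at depth `r` is asymptotically the Gaussian
parameter of the log-ratio at depth `r + 1`. -/
lemma eventually_risk_treeExperiment_lt (h0 : 0 < p) (h1 : p < 1) {lam : ℝ} (hlam : 0 ≤ lam)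
    {η : ℝ → ℝ} (hη : ∀ᶠ d in atTop, d * η d ^ 2 = lam)
    (hκ : ∀ᶠ d in atTop, ∀ x y, 0 < kernel p (η d) x y) (r : ℕ) {ε : ℝ} (hε : 0 < ε) :
    ∀ᶠ d in atTop, risk [treeExperiment (kernel p (η d)) d (r + 1)] signCoeff <
      ENNReal.ofReal (2 * (gaussianSuccess (muSeq p lam 1 r) + ε)) := by
  by_contra hcon
  -- The limit theorems are stated for sequences, so failure along the real filter is turned into a
  -- sequence of bad degrees.
  obtain ⟨d, hd, hall⟩ := exists_seq_forall_of_frequently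
    (((not_eventually.1 hcon).and_eventually hη).and_eventually
      (hκ.and (eventually_ge_atTop 0)))
  have hd0 := fun n => (hall n).2.2
  have hκ' := fun n => (hall n).2.1
  have hη' := fun n => (hall n).1.2
  have hν := fun n => isExperiment_treeExperiment (hκ' n) (sum_kernel p (η (d n))) (hd0 n) r
  have hμ := muSeq_nonneg h0 h1 hlam r
  have hlim := tendsto_integral_compoundPoisson (η := fun n => η (d n)) h0 h1 hd hη' hκ' hd0 hν hμ
    (tendsto_infoV_treeExperiment (η := fun n => η (d n)) h0 h1 hlam hd hη' hκ' hd0 r)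
    continuous_gain (B := 1) fun u => by
      rw [abs_of_nonneg (gain_nonneg u)]; exact gain_le_one u
  rw [integral_gain_eq_gaussianSuccess hμ] at hlim
  obtain ⟨n, hn⟩ := (hlim.eventually (gt_mem_nhds (lt_add_of_pos_right _ hε))).exists
  refine (hall n).1.1 ?_
  have := isProbabilityMeasure_jump (hκ' n) (sum_kernel p (η (d n))) (hν n)
  have := isProbabilityMeasure_compoundPoisson (hd0 n)
    (jump (kernel p (η (d n))) (treeExperiment (kernel p (η (d n))) (d n) r))
  rw [treeExperiment, nextLevel, risk_map_likPair (lintegral_exp_compoundPoisson (hd0 n) _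
    (lintegral_exp_jump (hκ' n) (sum_kernel p (η (d n))) (hν n)))]
  have hg : 0 ≤ ∫ u, gain u ∂(compoundPoisson (d n)
      (jump (kernel p (η (d n))) (treeExperiment (kernel p (η (d n))) (d n) r))) :=
    integral_nonneg gain_nonneg
  exact (ENNReal.ofReal_lt_ofReal_iff (by linarith)).2 (by linarith)

end Limit

/-! ### Translation of the parameters `a`, `b`, `c` into a weak kernel. -/

section Threshold

/-- The symmetric matrix of normalized connectivities, as a function on unordered pairs. -/
def edgeRatio (a b c : ℝ) (e : Sym2 (Fin 2)) : ℝ :=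
  Sym2.lift ⟨fun x y => !![a, b; b, c] x y, fun x y => by fin_cases x <;> fin_cases y <;> rfl⟩ e

variable {p a b c : ℝ}

lemma transition_edgeRatio (hab : p * a + (1 - p) * b = 1)
    (hbc : p * b + (1 - p) * c = 1) :
    transition p (edgeRatio a b c) = kernel p (1 - b) := by
  funext x y
  fin_cases x <;> fin_cases y <;>
    simp [transition, edgeRatio, kernel, labelProb] <;> linarith

lemma admissible_edgeRatio (h0 : 0 < p) (h1 : p < 1) {d : ℝ} (hd : 0 < d)
    (hab : p * a + (1 - p) * b = 1) (hbc : p * b + (1 - p) * c = 1)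
    (ha : 0 < a) (hb : 0 < b) (hc : 0 < c) : Admissible p d (edgeRatio a b c) where
  p_pos := h0
  p_lt_one := h1
  d_pos := hd
  pos e := by
    induction e using Sym2.ind with
    | _ x y => fin_cases x <;> fin_cases y <;> simpa [edgeRatio]
  row x := by fin_cases x <;> simp [edgeRatio, labelProb] <;> linarith

/-- The constraint forces `|1 - b| = √(lam / d) → 0`; once this is below `min p (1 - p)`, the two
normalisations make all entries positive. -/
lemma eventually_pos_of_normalized {p lam : ℝ} (h0 : 0 < p) (h1 : p < 1) {a b c : ℝ → ℝ}
    (hab : ∀ᶠ d : ℝ in atTop, p * a d + (1 - p) * b d = 1)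
    (hbc : ∀ᶠ d : ℝ in atTop, p * b d + (1 - p) * c d = 1)
    (hl : ∀ᶠ d : ℝ in atTop, d * (1 - b d) ^ 2 = lam) :
    ∀ᶠ d : ℝ in atTop, 0 < a d ∧ 0 < b d ∧ 0 < c d := by
  have hq : 0 < 1 - p := by linarith
  have h2 := tendsto_sqrt_div_atTop lam (tendsto_id (x := (atTop : Filter ℝ)))
  filter_upwards [hab, hbc, hl, eventually_gt_atTop 0,
    h2.eventually (gt_mem_nhds (lt_min h0 hq))] with d e1 e2 e3 hd hs
  rw [id] at hs
  rw [← e3, mul_div_cancel_left₀ _ hd.ne', Real.sqrt_sq_eq_abs] at hs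
  obtain ⟨s1, s2⟩ := lt_min_iff.1 hs
  obtain ⟨l1, u1⟩ := abs_lt.1 s1
  obtain ⟨l2, u2⟩ := abs_lt.1 s2
  have hb : 0 < b d := by linarith
  refine ⟨(mul_pos_iff_of_pos_left h0).1 ?_, hb, (mul_pos_iff_of_pos_left hq).1 ?_⟩
  · have := mul_pos hq (show 0 < 1 - b d + p by linarith)
    have e : p * a d = p ^ 2 + (1 - p) * (1 - b d + p) := by linear_combination e1
    rw [e]; positivity
  · have := mul_pos h0 (show 0 < 1 - b d + (1 - p) by linarith)
    have e : (1 - p) * c d = (1 - p) ^ 2 + p * (1 - b d + (1 - p)) := by linear_combination e2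
    rw [e]; positivity

end Threshold

end SBM

/-! ### The limits in `n`, `d` and the depth combined. -/

theorem mainTheorem7 (p lam : ℝ) (hp0 : 0 < p) (hp1 : p ≤ 1 / 2) (hlam : 0 ≤ lam)
    (a b c : ℝ → ℝ)
    (hab : ∀ᶠ d : ℝ in atTop, p * a d + (1 - p) * b d = 1)
    (hbc : ∀ᶠ d : ℝ in atTop, p * b d + (1 - p) * c d = 1)
    (hl : ∀ᶠ d : ℝ in atTop, d * (1 - b d) ^ 2 = lam) :
    ∃ μinf : ℝ, 0 ≤ μinf ∧ Tendsto (SBM.muSeq p lam 1) atTop (𝓝 μinf) ∧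
      limsup (fun d : ℝ => limsup (fun n : ℕ =>
          ((SBM.successProb p (SBM.connectivity (a d) (b d) (c d) d n)
            (SBM.optimalTest (n := n) p (SBM.connectivity (a d) (b d) (c d) d n)) : ℝ) : EReal))
          atTop) atTop
        ≤ ((SBM.gaussianSuccess μinf : ℝ) : EReal) := by
  have h1 : p < 1 := by linarith
  obtain ⟨μ, hμ0, hμ⟩ := SBM.exists_tendsto_muSeq hp0 h1 hlam
  refine ⟨μ, hμ0, hμ, ?_⟩
  have hpos := SBM.eventually_pos_of_normalized hp0 h1 hab hbc hl
  have hκ : ∀ᶠ d in atTop, ∀ x y, 0 < SBM.kernel p (1 - b d) x y := by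
    filter_upwards [hab, hbc, hpos, eventually_gt_atTop 0] with d e1 e2 hp hd
    rw [← SBM.transition_edgeRatio e1 e2]
    exact (SBM.admissible_edgeRatio hp0 h1 hd e1 e2 hp.1 hp.2.1 hp.2.2).transition_pos
  have hstep : ∀ (r : ℕ) (ε : ℝ), 0 < ε → limsup (fun d : ℝ => limsup (fun n : ℕ =>
      ((SBM.successProb p (SBM.connectivity (a d) (b d) (c d) d n)
        (SBM.optimalTest (n := n) p (SBM.connectivity (a d) (b d) (c d) d n)) : ℝ) : EReal))
      atTop) atTop ≤ ((SBM.gaussianSuccess (SBM.muSeq p lam 1 r) + ε : ℝ) : EReal) := by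
    intro r ε hε
    refine limsup_le_of_le (by isBoundedDefault) ?_
    filter_upwards [hab, hbc, hpos, eventually_gt_atTop 0,
      SBM.eventually_risk_treeExperiment_lt hp0 h1 hlam hl hκ r hε] with d e1 e2 hp hd hr
    rw [← SBM.transition_edgeRatio e1 e2] at hr
    refine limsup_le_of_le (by isBoundedDefault) ?_
    filter_upwards [SBM.eventually_successProb_le
      (SBM.admissible_edgeRatio hp0 h1 hd e1 e2 hp.1 hp.2.1 hp.2.2) (r + 1)
      (M := SBM.connectivity (a d) (b d) (c d) d) (fun n x y => rfl) hr] with n hn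
    exact EReal.coe_le_coe_iff.2 (hn _)
  -- The slack `ε = 1 / (r + 1)` is tied to the depth, so a single limit in `r` removes both.
  have hgs : Tendsto (fun r : ℕ => SBM.gaussianSuccess (SBM.muSeq p lam 1 r) + 1 / ((r : ℝ) + 1))
      atTop (𝓝 (SBM.gaussianSuccess μ)) := by
    have hnn := fun r => SBM.muSeq_nonneg hp0 h1 hlam r
    have h := (SBM.continuousOn_integral_gain μ hμ0).tendsto.comp
      (tendsto_nhdsWithin_iff.2 ⟨hμ, Eventually.of_forall hnn⟩)
    rw [SBM.integral_gain_eq_gaussianSuccess hμ0] at h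
    have h' := h.add (tendsto_one_div_add_atTop_nhds_zero_nat (𝕜 := ℝ))
    rw [add_zero] at h'
    refine h'.congr fun r => ?_
    rw [Function.comp_apply, SBM.integral_gain_eq_gaussianSuccess (hnn r)]
  exact ge_of_tendsto' ((continuous_coe_real_ereal.tendsto _).comp hgs)
    fun r => hstep r _ Nat.one_div_pos_of_nat
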